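/- **Setting.** Let $X,Y$ be (real or complex) Hilbert spaces, $A:X\to Y$ a bounded linear operator, and $G:X\to X$ a bounded, injective, positive self-adjoint operator; $B:=G^{-1}$ is the (in general unbounded) generator of the Hilbert scale, $B^{r}=G^{-r}$ for $r\in\mathbb R$, and $a:=\|G\|$. A function $\varrho$ on $(0,a]$ is an *index function* if it is continuous and strictly increasing with $\varrho(0+)=0$ (it is extended by $\varrho(0)=0$). Let $\varrho$ be an index function on $(0,a]$, let $p>0$, $s\in\mathbb R$, $x_0\in X$, and put $\psi_r(t):=t^r\varrho(t)$ on $(0,a]$; assume that $\psi_s$ is an index function (automatic for $s\ge 0$). For an index function $\psi$ on $(0,a]$ put $\psi^{-1}(\tau):=a$ if $\tau>\psi(a)$. Let $$h(t):=\bigl[\psi_s^{-1}(\sqrt t)\bigr]^{p-s},\qquad w(t):=1/h(t)\qquad (0<t\le b:=\psi_s(a)^2),\qquad \xi_p(t):=\psi_p\bigl(t^{1/(2p)}\bigr)^2\quad(0<t\le a^{2p}).$$ A function $f$ on $(0,b]$ is called *operator monotone* if $S_1\le S_2$ implies $f(S_1)\le f(S_2)$ for all self-adjoint bounded operators $S_1,S_2$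 on $X$ with spectra in $(0,b]$. **Method.** For $y^\delta\in Y$, an integer $n\ge 0$ and $\alpha_1,\dots,\alpha_n>0$ let $x_0^\delta=x_0$ and $$x_k^\delta=x_{k-1}^\delta-(A^*A+\alpha_kB^{2s})^{-1}A^*(Ax_{k-1}^\delta-y^\delta),\qquad k=1,\dots,n .$$ **Theorem.** Let $0<m\le M$, $E>0$ and $1<C_1\le C_2$. There are constants $c_1,c_2,c_3>0$, depending only on $m,M,E,C_1,C_2$, such that the following holds in every setting as above. Assume the two link conditions $$m\|\varrho(G)x\|\le\|Ax\|\le M\|\varrho(G)x\|\qquad\text{for all }x\in X,$$ assume that $\xi_p$ is convex, and assume that at least one of the following holds: (i) (high order) $s\ge p$ and $w^2$ is operator monotone on $(0,b]$; (ii) (low order) $s\le p$, $h^2$ is operator monotone on $(0,b]$, and $h(t)/\sqrt t$ is (not necessarily strictly) decreasing on $(0,b]$. Let $M_{p,E}:=\{x\in X: x-x_0=G^pv\text{ for some }v\in X\text{ with }\|v\|\le E\}$. (a) For all $\delta>0$, $x^\dagger\in M_{p,E}$ and $y^\delta\in Y$ with $\|Ax^\dagger-y^\delta\|\le\delta$,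 and for all $n$ and $\alpha_1,\dots,\alpha_n>0$ chosen such that the discrepancy principle $C_1\delta\le\|Ax_n^\delta-y^\delta\|\le C_2\delta$ is satisfied, $$\|x_n^\delta-x^\dagger\|\le c_1\bigl[\psi_p^{-1}(c_2\delta)\bigr]^p .$$ (b) This bound is order optimal on $M_{p,E}$: for every $\delta>0$ such that $\delta/(ME)$ belongs to the spectrum of $\psi_p(G)$, $$c_1\bigl[\psi_p^{-1}(c_2\delta)\bigr]^p\le c_3\,\inf_{R:Y\to X}\ \sup\bigl\{\|Ry^\delta-x^\dagger\| : x^\dagger\in M_{p,E},\ y^\delta\in Y,\ \|Ax^\dagger-y^\delta\|\le\delta\bigr\},$$ where the infimum is over arbitrary maps $R:Y\to X$. -/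

import Mathlib

open scoped InnerProductSpace ENNReal

noncomputable section

namespace HilbertScale

section Operators

variable {𝕜 X Y : Type*} [RCLike 𝕜]
  [NormedAddCommGroup X] [InnerProductSpace 𝕜 X] [CompleteSpace X]
  [NormedAddCommGroup Y] [InnerProductSpace 𝕜 Y] [CompleteSpace Y]

/-- `F = f(S)` in the sense of the continuous functional calculus of a bounded self-adjoint
operator `S` on a real or complex Hilbert space: `F` is the operator-norm limit of `q(S)` along
real polynomials `q` that converge to `f` uniformly on the spectrum of `S`. -/
def IsFunctionOf (S : X →L[𝕜] X) (f : ℝ → ℝ) (F : X →L[𝕜] X) : Prop :=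
  ∀ ε : ℝ, 0 < ε → ∃ q : Polynomial ℝ,
    (∀ t : ℝ, (t : 𝕜) ∈ spectrum 𝕜 S → |q.eval t - f t| ≤ ε) ∧
      ‖F - Polynomial.aeval S (q.map (algebraMap ℝ 𝕜))‖ ≤ ε

open Classical in
/-- The operator `f(S)`, for `S` bounded self-adjoint and `f` continuous on the spectrum of `S`. -/
def opFun (S : X →L[𝕜] X) (f : ℝ → ℝ) : X →L[𝕜] X :=
  if h : ∃ F : X →L[𝕜] X, IsFunctionOf S f F then h.choose else 0

/-- The bounded operator `G ^ r`, for `0 ≤ r` and `G` bounded, positive and self-adjoint. -/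
def opPow (G : X →L[𝕜] X) (r : ℝ) : X →L[𝕜] X :=
  opFun G (fun t => t ^ r)

/-- The (possibly unbounded) operator `G ^ r` with its natural domain, for an arbitrary real `r`
and `G` bounded, positive, self-adjoint and injective: everywhere defined if `0 ≤ r`, and
the inverse of `G ^ (-r)`, with domain the range of `G ^ (-r)`, if `r < 0`.
With `B = G⁻¹` one has `B ^ r = G ^ (-r)`. -/
def scalePow (G : X →L[𝕜] X) (r : ℝ) : X →ₗ.[𝕜] X :=
  if 0 ≤ r then (opPow G r).toLinearMap.toPMap ⊤
  else ((opPow G (-r)).toLinearMap.toPMap ⊤).inverse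

/-- The first `n` steps of the implicit iteration in the Hilbert scale of `B = G⁻¹`:
`x k = x (k-1) - (A* A + α k B ^ (2 s))⁻¹ A* (A (x (k-1)) - y)` for `k = 1, …, n`, and `x 0 = x₀`.
The correction `z` is the solution of `(A* A + α k B ^ (2 s)) z = A* (A (x (k-1)) - y)` in the
domain of `B ^ (2 s)`. -/
def IsImplicitIteration (A : X →L[𝕜] Y) (G : X →L[𝕜] X) (s : ℝ) (α : ℕ → ℝ) (y : Y) (x₀ : X)
    (n : ℕ) (x : ℕ → X) : Prop :=
  x 0 = x₀ ∧
    ∀ k ∈ Finset.Icc 1 n, ∃ z : (scalePow G (-(2 * s))).domain,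
      A.adjoint (A (z : X)) + (α k : 𝕜) • scalePow G (-(2 * s)) z
          = A.adjoint (A (x (k - 1)) - y) ∧
        x k = x (k - 1) - (z : X)

/-- The set `M_{p,E}` of all `x` with `‖G ^ (-p) (x - x₀)‖ ≤ E`. -/
def sourceSet (G : X →L[𝕜] X) (x₀ : X) (p E : ℝ) : Set X :=
  {x | ∃ v : X, ‖v‖ ≤ E ∧ x - x₀ = opPow G p v}

/-- The worst case error on `S` of a method `R`, i.e. of an arbitrary map `R : Y → X`, for the
equation `A x = y` with noise level `δ`. -/
def worstCaseError (A : X →L[𝕜] Y) (S : Set X) (δ : ℝ) (R : Y → X) : ℝ≥0∞ :=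
  ⨆ (x ∈ S) (yδ : Y) (_ : ‖A x - yδ‖ ≤ δ), ENNReal.ofReal ‖R yδ - x‖

/-- The best possible worst case error on `S`. -/
def bestWorstCaseError (A : X →L[𝕜] Y) (S : Set X) (δ : ℝ) : ℝ≥0∞ :=
  ⨅ R : Y → X, worstCaseError A S δ R

variable (𝕜 X) in
/-- `f` is operator monotone on `(0, b]` (for operators on `X`): for self-adjoint `S₁`, `S₂` with
spectra in `(0, b]`, the relation `S₁ ≤ S₂` implies `f(S₁) ≤ f(S₂)`. Here `≤` is the Loewner
order. -/
def OperatorMonotone (b : ℝ) (f : ℝ → ℝ) : Prop :=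
  ∀ S₁ S₂ : X →L[𝕜] X, IsSelfAdjoint S₁ → IsSelfAdjoint S₂ →
    spectrum 𝕜 S₁ ⊆ (fun t : ℝ => (t : 𝕜)) '' Set.Ioc 0 b →
    spectrum 𝕜 S₂ ⊆ (fun t : ℝ => (t : 𝕜)) '' Set.Ioc 0 b →
    S₁ ≤ S₂ → opFun S₁ f ≤ opFun S₂ f

end Operators

/-- An index function on `(0, a]`: continuous, strictly increasing, with limit `0` at `0+`.
It is extended to `0` by the value `0`. -/
def IsIndexFunction (a : ℝ) (ϱ : ℝ → ℝ) : Prop :=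
  ϱ 0 = 0 ∧ ContinuousOn ϱ (Set.Icc 0 a) ∧ StrictMonoOn ϱ (Set.Icc 0 a)

/-- The function `ψ_r(t) = t ^ r ϱ(t)`. -/
def psi (ϱ : ℝ → ℝ) (r t : ℝ) : ℝ := t ^ r * ϱ t

/-- The inverse of an index function `ψ` on `(0, a]`. Arguments larger than `ψ a` are sent
to `a`. -/
def indexInv (a : ℝ) (ψ : ℝ → ℝ) (τ : ℝ) : ℝ := sSup {t | t ∈ Set.Icc 0 a ∧ ψ t ≤ τ}

/-- The function `h(t) = [ψ_s⁻¹(√t)] ^ (p - s)` for `0 < t ≤ ψ_s(a)²`. -/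
def hFun (a : ℝ) (ϱ : ℝ → ℝ) (p s t : ℝ) : ℝ := indexInv a (psi ϱ s) (√t) ^ (p - s)

/-- The function `w = 1 / h`. -/
def wFun (a : ℝ) (ϱ : ℝ → ℝ) (p s t : ℝ) : ℝ := 1 / hFun a ϱ p s t

/-- The function `ξ_r(t) = ψ_r(t ^ (1 / (2 r)))²`. -/
def xiFun (ϱ : ℝ → ℝ) (r t : ℝ) : ℝ := psi ϱ r (t ^ (1 / (2 * r))) ^ 2

end HilbertScale

end

/-! The link conditions make `A` behave like `ϱ(G)`, so everything reduces to two facts about the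
final error `x n - x†`: it equals `G^p v'` with `‖v'‖` bounded by a constant E', and its image under
`A` is at most `(C₂ + 1) δ`. The lower link condition then gives `‖ψ_p(G) v'‖ ≤ τ δ`, and
interpolation between this and `‖v'‖ ≤ E'` (`norm_opPow_le`) yields the rate: split the spectrum of
`G` at `t₀` with `ψ_p(t₀) = τ δ / E'`. Below `t₀` use `t^p ≤ t₀^p`; above it use that `t^p / ψ_p(t)
= 1 / ϱ(t)` decreases.

The source representation is the main point. With `T` equal to `A G^s` (extended by continuity if `s
≤ 0`), the substitution `x = x₀ + G^s U` turns the method into ordinary iterated Tikhonov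
regularization for `W = T* T`. Hence the transformed iterates are `r(W) V₀ + g(W) T* ζ` with
explicit scalar functions `r` and `g` (`iteration_eq`). The link condition for `T` says `m² ψ_s(G)²
≤ W ≤ M² ψ_s(G)²`. Operator monotonicity of the squared link function transfers this to `G^|p-s|`
and a function `φ(W)`, with constants 1 and `m / M` (`link_of_operatorMonotone`).

All filter estimates then become scalar. With `σ = ∑ 1/α k` and the cut-off `l = min(B, 1/σ)`, the
noise enters the source element with a factor `K₁`, while the noise-free residual is at most a
constant times `K₂ E`. The factors `φ(l)^(±1)` cancel, so `K₁ K₂ = σ l ≤ 1`. Since the filter leaves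
at most `δ` of the noise in the residual, the lower discrepancy inequality forces `(C₁ - 1) δ` below
the noise-free residual. Therefore `K₁ δ` is bounded by a multiple of `E / (C₁ - 1)`, whatever the
`α k` and `n` are (`low_order_bound`, `high_order_bound`).

For optimality, an approximate eigenvector `v` of `G` at the point `t` with `ψ_p(t) = δ / (M E)`
produces two elements `x₀ ± (E/2) G^p v` that share the admissible datum `A x₀`. No method can be
close to both (`exists_lower_bound`). -/

noncomputable section

namespace HilbertScale

/-! ### Continuous functional calculus of a self-adjoint operator over real or complex scalars. -/

section FunctionalCalculus

open Polynomial

variable {𝕜 X : Type*} [RCLike 𝕜] [NormedAddCommGroup X] [InnerProductSpace 𝕜 X]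

/-- The real part of the spectrum of an operator. -/
def realSpectrum (S : X →L[𝕜] X) : Set ℝ := {t : ℝ | (t : 𝕜) ∈ spectrum 𝕜 S}

/-- The real polynomial `q` evaluated at the operator `S`, as a ring homomorphism. -/
def polyOp (S : X →L[𝕜] X) : ℝ[X] →+* (X →L[𝕜] X) :=
  (aeval S : 𝕜[X] →ₐ[𝕜] (X →L[𝕜] X)).toRingHom.comp (mapRingHom (algebraMap ℝ 𝕜))

theorem polyOp_apply (S : X →L[𝕜] X) (q : ℝ[X]) :
    polyOp S q = aeval S (q.map (algebraMap ℝ 𝕜)) := rfl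

@[simp] theorem polyOp_X (S : X →L[𝕜] X) : polyOp S Polynomial.X = S := by
  simp [polyOp_apply]

@[simp] theorem polyOp_C (S : X →L[𝕜] X) (c : ℝ) :
    polyOp S (C c) = (c : 𝕜) • (1 : X →L[𝕜] X) := by
  simp [polyOp_apply, Algebra.algebraMap_eq_smul_one]

theorem mem_realSpectrum {S : X →L[𝕜] X} {t : ℝ} :
    t ∈ realSpectrum S ↔ ¬ IsUnit (S - (t : 𝕜) • (1 : X →L[𝕜] X)) := by
  rw [realSpectrum, Set.mem_ofPred_eq, spectrum.mem_iff, IsUnit.sub_iff,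
    Algebra.algebraMap_eq_smul_one]

theorem norm_ofReal_smul {r : ℝ} (x : X) : ‖(r : 𝕜) • x‖ = |r| * ‖x‖ := by
  rw [norm_smul, RCLike.norm_ofReal]

theorem isFunctionOf_iff {S : X →L[𝕜] X} {f : ℝ → ℝ} {F : X →L[𝕜] X} :
    IsFunctionOf S f F ↔ ∀ ε : ℝ, 0 < ε → ∃ q : ℝ[X],
      (∀ t ∈ realSpectrum S, |q.eval t - f t| ≤ ε) ∧ ‖F - polyOp S q‖ ≤ ε := Iff.rfl

theorem isFunctionOf_polyOp (S : X →L[𝕜] X) (q : ℝ[X]) :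
    IsFunctionOf S (fun t => q.eval t) (polyOp S q) :=
  isFunctionOf_iff.mpr fun ε hε => ⟨q, by simp [hε.le], by simp [hε.le]⟩

theorem IsFunctionOf.congr {S : X →L[𝕜] X} {f g : ℝ → ℝ} {F : X →L[𝕜] X}
    (hF : IsFunctionOf S f F) (h : ∀ t ∈ realSpectrum S, f t = g t) : IsFunctionOf S g F := by
  rw [isFunctionOf_iff] at hF ⊢
  intro ε hε
  obtain ⟨q, h1, h2⟩ := hF ε hε
  exact ⟨q, fun t ht => h t ht ▸ h1 t ht, h2⟩

theorem IsFunctionOf.add {S : X →L[𝕜] X} {f g : ℝ → ℝ} {F H : X →L[𝕜] X}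
    (hF : IsFunctionOf S f F) (hH : IsFunctionOf S g H) :
    IsFunctionOf S (fun t => f t + g t) (F + H) := by
  rw [isFunctionOf_iff] at hF hH ⊢
  intro ε hε
  obtain ⟨q, h1, h2⟩ := hF (ε / 2) (half_pos hε)
  obtain ⟨r, h3, h4⟩ := hH (ε / 2) (half_pos hε)
  refine ⟨q + r, fun t ht => ?_, ?_⟩
  · rw [eval_add, add_sub_add_comm]
    linarith [abs_add_le (q.eval t - f t) (r.eval t - g t), h1 t ht, h3 t ht]
  · rw [map_add, add_sub_add_comm]
    linarith [norm_add_le (F - polyOp S q) (H - polyOp S r)]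

theorem IsFunctionOf.mul {S : X →L[𝕜] X} {f g : ℝ → ℝ} {F H : X →L[𝕜] X}
    (hF : IsFunctionOf S f F) (hH : IsFunctionOf S g H) {Cf Cg : ℝ}
    (hf : ∀ t ∈ realSpectrum S, |f t| ≤ Cf) (hg : ∀ t ∈ realSpectrum S, |g t| ≤ Cg) :
    IsFunctionOf S (fun t => f t * g t) (F * H) := by
  rw [isFunctionOf_iff] at hF hH ⊢
  intro ε hε
  -- `K` dominates the coefficients of `δ` in both product estimates; the cap `δ ≤ 1` makes the
  -- quadratic error terms linear.
  set K := |Cf| + |Cg| + ‖F‖ + ‖H‖ + 2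
  have hK : 0 < K := by positivity
  set δ := min 1 (ε / K)
  have hδ : 0 < δ := lt_min one_pos (div_pos hε hK)
  have hδ1 : δ ≤ 1 := min_le_left _ _
  have hδK : δ * K ≤ ε := (le_div_iff₀ hK).mp (min_le_right _ _)
  obtain ⟨q, h1, h2⟩ := hF δ hδ
  obtain ⟨r, h3, h4⟩ := hH δ hδ
  refine ⟨q * r, fun t ht => ?_, ?_⟩
  · have e : (q * r).eval t - f t * g t
        = (q.eval t - f t) * (r.eval t - g t) + (q.eval t - f t) * g t
          + f t * (r.eval t - g t) := by rw [eval_mul]; ring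
    rw [e]
    refine (abs_add_three _ _ _).trans ?_
    rw [abs_mul, abs_mul, abs_mul]
    have a1 : |q.eval t - f t| * |r.eval t - g t| ≤ δ * 1 :=
      mul_le_mul (h1 t ht) ((h3 t ht).trans hδ1) (abs_nonneg _) hδ.le
    have a2 : |q.eval t - f t| * |g t| ≤ δ * |Cg| :=
      mul_le_mul (h1 t ht) ((hg t ht).trans (le_abs_self _)) (abs_nonneg _) hδ.le
    have a3 : |f t| * |r.eval t - g t| ≤ |Cf| * δ :=
      mul_le_mul ((hf t ht).trans (le_abs_self _)) (h3 t ht) (abs_nonneg _) (abs_nonneg _)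
    have a4 : 0 ≤ δ * (‖F‖ + ‖H‖ + 1) := by positivity
    calc _ ≤ δ * 1 + δ * |Cg| + |Cf| * δ := by linarith
      _ ≤ δ * K := by simp only [K]; linarith
      _ ≤ ε := hδK
  · have e : F * H - polyOp S (q * r) = (F - polyOp S q) * H + F * (H - polyOp S r)
        - (F - polyOp S q) * (H - polyOp S r) := by rw [map_mul]; noncomm_ring
    rw [e]
    have b1 : ‖(F - polyOp S q) * H‖ ≤ δ * ‖H‖ :=
      (norm_mul_le _ _).trans (mul_le_mul_of_nonneg_right h2 (norm_nonneg _))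
    have b2 : ‖F * (H - polyOp S r)‖ ≤ ‖F‖ * δ :=
      (norm_mul_le _ _).trans (mul_le_mul_of_nonneg_left h4 (norm_nonneg _))
    have b3 : ‖(F - polyOp S q) * (H - polyOp S r)‖ ≤ δ * 1 :=
      (norm_mul_le _ _).trans (mul_le_mul h2 (h4.trans hδ1) (norm_nonneg _) hδ.le)
    have b4 : 0 ≤ δ * (|Cf| + |Cg| + 1) := by positivity
    calc _ ≤ ‖(F - polyOp S q) * H‖ + ‖F * (H - polyOp S r)‖
          + ‖(F - polyOp S q) * (H - polyOp S r)‖ :=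
            (norm_sub_le _ _).trans (by gcongr; exact norm_add_le _ _)
      _ ≤ δ * K := by simp only [K]; linarith
      _ ≤ ε := hδK

theorem IsFunctionOf.const_mul {S : X →L[𝕜] X} {f : ℝ → ℝ} {F : X →L[𝕜] X}
    (hF : IsFunctionOf S f F) (c : ℝ) : IsFunctionOf S (fun t => c * f t) ((c : 𝕜) • F) := by
  rw [isFunctionOf_iff] at hF ⊢
  intro ε hε
  have hc : 0 < |c| + 1 := by positivity
  obtain ⟨q, h1, h2⟩ := hF (ε / (|c| + 1)) (div_pos hε hc)
  have key : ∀ r : ℝ, r ≤ ε / (|c| + 1) → 0 ≤ r → |c| * r ≤ ε := by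
    intro r hr hr0
    have := (le_div_iff₀ hc).mp hr
    nlinarith [abs_nonneg c]
  refine ⟨C c * q, fun t ht => ?_, ?_⟩
  · rw [eval_mul, eval_C, ← mul_sub, abs_mul]
    exact key _ (h1 t ht) (abs_nonneg _)
  · rw [map_mul, polyOp_C, smul_mul_assoc, one_mul, ← smul_sub, norm_smul, RCLike.norm_ofReal]
    exact key _ h2 (norm_nonneg _)

variable [CompleteSpace X]

theorem isSelfAdjoint_polyOp {S : X →L[𝕜] X} (hS : IsSelfAdjoint S) (q : ℝ[X]) :
    IsSelfAdjoint (polyOp S q) := by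
  induction q using Polynomial.induction_on' with
  | add p q hp hq => rw [map_add]; exact hp.add hq
  | monomial n a =>
    rw [← C_mul_X_pow_eq_monomial, map_mul, map_pow, polyOp_C, polyOp_X, smul_mul_assoc, one_mul]
    refine IsSelfAdjoint.smul ?_ (hS.pow n)
    simp [isSelfAdjoint_iff]

/-- The quadratic form is `‖(S - u) x‖² + b² ‖x‖²`, hence coercive. This disposes of the irreducible
quadratic factors of a real polynomial, so that real scalars need no complexification. -/
theorem isUnit_quadratic {S : X →L[𝕜] X} (hS : IsSelfAdjoint S) (u b : ℝ) (hb : b ≠ 0) :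
    IsUnit ((S - (u : 𝕜) • 1) * (S - (u : 𝕜) • 1) + ((b ^ 2 : ℝ) : 𝕜) • (1 : X →L[𝕜] X)) := by
  have hV : IsSelfAdjoint (S - (u : 𝕜) • (1 : X →L[𝕜] X)) := by
    refine hS.sub (IsSelfAdjoint.smul ?_ (IsSelfAdjoint.one _))
    simp [isSelfAdjoint_iff]
  set V := S - (u : 𝕜) • (1 : X →L[𝕜] X)
  refine ContinuousLinearMap.isUnit_of_forall_le_norm_inner_map _
    (c := ⟨b ^ 2, sq_nonneg b⟩) (by change 0 < b ^ 2; positivity) fun x => ?_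
  change ‖x‖ ^ 2 * b ^ 2 ≤ _
  refine le_trans ?_ (RCLike.re_le_norm _)
  have h1 : ⟪V (V x), x⟫_𝕜 = ⟪V x, V x⟫_𝕜 := by
    rw [← ContinuousLinearMap.adjoint_inner_right, hV.adjoint_eq]
  simp only [add_apply, mul_apply_eq_comp, inner_add_left,
    smul_apply, one_apply_eq_self, inner_smul_left, h1, map_add,
    RCLike.conj_ofReal, RCLike.re_ofReal_mul, inner_self_eq_norm_sq]
  nlinarith [sq_nonneg ‖V x‖]

/-- Split off a real linear or quadratic factor. If its value at `S` is invertible, the cofactor is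
not and has smaller degree. Otherwise the factor must be linear, and its root lies in the spectrum.
-/
theorem exists_root_of_not_isUnit {S : X →L[𝕜] X} (hS : IsSelfAdjoint S) :
    ∀ (n : ℕ) (p : ℝ[X]), p ≠ 0 → p.natDegree ≤ n → ¬ IsUnit (polyOp S p) →
      ∃ t ∈ realSpectrum S, p.eval t = 0 := by
  intro n
  induction n using Nat.strong_induction_on with
  | _ n ih =>
  intro p hp hn hu
  by_cases hd : p.natDegree = 0
  · exfalso
    rw [eq_C_of_natDegree_eq_zero hd] at hu hp
    have hc : p.coeff 0 ≠ 0 := fun h => hp (by simp [h])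
    refine hu ?_
    rw [polyOp_C, ← Algebra.algebraMap_eq_smul_one]
    exact (IsUnit.mk0 _ (by simpa using hc)).map (algebraMap 𝕜 (X →L[𝕜] X))
  have step : ∀ r : ℝ[X], 0 < r.natDegree → r ∣ p →
      (¬ IsUnit (polyOp S r) → ∃ t ∈ realSpectrum S, r.eval t = 0) →
      ∃ t ∈ realSpectrum S, p.eval t = 0 := by
    rintro r hr ⟨p', rfl⟩ h
    by_cases hru : IsUnit (polyOp S r)
    · have hp' : p' ≠ 0 := right_ne_zero_of_mul hp
      have hr0 : r ≠ 0 := left_ne_zero_of_mul hp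
      rw [natDegree_mul hr0 hp'] at hn
      have hpu : ¬ IsUnit (polyOp S p') := fun h' => hu (by rw [map_mul]; exact hru.mul h')
      obtain ⟨t, ht, h0⟩ := ih p'.natDegree (by omega) p' hp' le_rfl hpu
      exact ⟨t, ht, by simp [h0]⟩
    · obtain ⟨t, ht, h0⟩ := h hru
      exact ⟨t, ht, by simp [h0]⟩
  obtain ⟨z, hz⟩ := Complex.exists_root (f := p.map (algebraMap ℝ ℂ))
    (by rw [degree_map]; exact natDegree_pos_iff_degree_pos.mp (Nat.pos_of_ne_zero hd))
  have hz' : aeval z p = 0 := by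
    rwa [IsRoot, eval_map_algebraMap] at hz
  by_cases him : z.im = 0
  · have hzr : z = ((z.re : ℝ) : ℂ) := by apply Complex.ext <;> simp [him]
    have h0 : p.eval z.re = 0 := by
      rw [hzr, ← Complex.coe_algebraMap, aeval_algebraMap_apply] at hz'
      simpa using hz'
    refine step (Polynomial.X - C z.re) (by simp) (dvd_iff_isRoot.mpr h0) fun hnu => ?_
    refine ⟨z.re, ?_, by simp⟩
    rw [mem_realSpectrum]
    simpa using hnu
  · refine step _ ?_ (quadratic_dvd_of_aeval_eq_zero_im_ne_zero p hz' him) fun hnu => ?_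
    · have : (Polynomial.X ^ 2 - C (2 * z.re) * Polynomial.X + C (‖z‖ ^ 2) : ℝ[X]).natDegree = 2 := by
        compute_degree!
      omega
    · exfalso
      refine hnu ?_
      have h2 : (Polynomial.X ^ 2 - C (2 * z.re) * Polynomial.X + C (‖z‖ ^ 2) : ℝ[X])
          = (Polynomial.X - C z.re) * (Polynomial.X - C z.re) + C (z.im ^ 2) := by
        have : ‖z‖ ^ 2 = z.re * z.re + z.im ^ 2 := by
          rw [Complex.sq_norm, Complex.normSq_apply]; ring
        rw [this, map_add, map_mul, map_mul, show (C (2 : ℝ)) = 2 from rfl]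
        ring
      rw [h2, map_add, map_mul, map_sub, polyOp_C, polyOp_C, polyOp_X]
      exact isUnit_quadratic hS z.re z.im him

/-- The norm of a self-adjoint operator is the supremum of its absolute Rayleigh quotients. If
neither of `±‖S‖` were spectral, these would be bounded away from `‖S‖`. -/
theorem norm_mem_realSpectrum [Nontrivial X] {S : X →L[𝕜] X} (hS : IsSelfAdjoint S) :
    ‖S‖ ∈ realSpectrum S ∨ -‖S‖ ∈ realSpectrum S := by
  by_contra! h
  obtain ⟨c, hc0, hc⟩ := S.abs_rayleighQuotient_le_of_norm_mem_resolventSet (𝕜 := 𝕜)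
    (by simpa [realSpectrum, spectrum] using h.1) (by simpa [realSpectrum, spectrum] using h.2)
  grind [ciSup_le hc, ContinuousLinearMap.norm_eq_iSup_rayleighQuotient S hS.isSymmetric]

theorem exists_eval_eq {S : X →L[𝕜] X} (hS : IsSelfAdjoint S) (q : ℝ[X]) {μ : ℝ}
    (hμ : μ ∈ realSpectrum (polyOp S q)) : ∃ t ∈ realSpectrum S, q.eval t = μ := by
  have hX : Nontrivial X := by
    by_contra hX
    rw [not_nontrivial_iff_subsingleton] at hX
    rw [mem_realSpectrum] at hμ
    exact hμ (isUnit_of_subsingleton _)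
  by_cases h0 : q - C μ = 0
  · rw [sub_eq_zero.mp h0]
    -- Here `q` is the constant `μ`, so any spectral point will do; one of `±‖S‖` provides it.
    rcases norm_mem_realSpectrum hS with h | h <;> exact ⟨_, h, by simp⟩
  · obtain ⟨t, ht, h⟩ := exists_root_of_not_isUnit hS _ (q - C μ) h0 le_rfl
      (by rw [map_sub, polyOp_C]; exact mem_realSpectrum.mp hμ)
    refine ⟨t, ht, ?_⟩
    simpa [sub_eq_zero] using h

/-- The estimate on which the whole calculus rests: `q(S)` is self-adjoint, so one of `±‖q(S)‖` is
in its spectrum and therefore a value of `q` on the spectrum of `S`. -/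
theorem norm_polyOp_le {S : X →L[𝕜] X} (hS : IsSelfAdjoint S) (q : ℝ[X]) {C : ℝ} (hC : 0 ≤ C)
    (h : ∀ t ∈ realSpectrum S, |q.eval t| ≤ C) : ‖polyOp S q‖ ≤ C := by
  rcases subsingleton_or_nontrivial X with hX | hX
  · rw [Subsingleton.elim (polyOp S q) 0, norm_zero]; exact hC
  · rcases norm_mem_realSpectrum (isSelfAdjoint_polyOp hS q) with h' | h' <;>
    · obtain ⟨t, ht, ht'⟩ := exists_eval_eq hS q h'
      have := h t ht
      rw [ht'] at this
      simpa using this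

theorem abs_le_of_mem_realSpectrum {S : X →L[𝕜] X} {t : ℝ} (ht : t ∈ realSpectrum S) :
    |t| ≤ ‖S‖ := by
  have h := spectrum.norm_le_norm_mul_of_mem ht
  rw [RCLike.norm_ofReal] at h
  exact h.trans (mul_le_of_le_one_right (norm_nonneg _) ContinuousLinearMap.norm_id_le)

theorem isCompact_realSpectrum (S : X →L[𝕜] X) : IsCompact (realSpectrum S) := by
  refine Metric.isCompact_of_isClosed_isBounded
    ((spectrum.isClosed S).preimage RCLike.continuous_ofReal) ?_
  refine (Metric.isBounded_Icc (-‖S‖) ‖S‖).subset fun t ht => ?_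
  exact abs_le.mp (abs_le_of_mem_realSpectrum ht)

theorem exists_polynomial_near {K : Set ℝ} (hK : IsCompact K) {f : ℝ → ℝ} (hf : ContinuousOn f K)
    {ε : ℝ} (hε : 0 < ε) : ∃ q : ℝ[X], ∀ t ∈ K, |q.eval t - f t| ≤ ε := by
  have := isCompact_iff_compactSpace.mp hK
  obtain ⟨⟨g, hg⟩, h⟩ := ContinuousMap.exists_mem_subalgebra_near_continuous_of_separatesPoints
    (polynomialFunctions K) (polynomialFunctions_separatesPoints K) (K.domRestrict f) hf.domRestrict
    ε hε
  rw [← SetLike.mem_coe, polynomialFunctions_coe] at hg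
  obtain ⟨q, rfl⟩ := hg
  exact ⟨q, fun t ht => (h ⟨t, ht⟩).le⟩

/-- Weierstrass approximation on the compact spectrum gives polynomials `q n`; by `norm_polyOp_le`
the operators `q n (S)` form a Cauchy sequence. -/
theorem exists_isFunctionOf {S : X →L[𝕜] X} (hS : IsSelfAdjoint S) {f : ℝ → ℝ}
    (hf : ContinuousOn f (realSpectrum S)) : ∃ F, IsFunctionOf S f F := by
  have hpos : ∀ n : ℕ, (0 : ℝ) < 1 / ((n : ℝ) + 1) := fun n => by positivity
  choose q hq using fun n : ℕ => exists_polynomial_near (isCompact_realSpectrum S) hf (hpos n)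
  have hdist : ∀ m n : ℕ, ‖polyOp S (q m) - polyOp S (q n)‖ ≤ 1 / ((m : ℝ) + 1) + 1 / (n + 1) := by
    intro m n
    rw [← map_sub]
    refine norm_polyOp_le hS _ (add_pos (hpos m) (hpos n)).le fun t ht => ?_
    rw [eval_sub, show (q m).eval t - (q n).eval t
      = ((q m).eval t - f t) - ((q n).eval t - f t) by ring]
    exact (abs_sub _ _).trans (add_le_add (hq m t ht) (hq n t ht))
  have hC : CauchySeq fun n => polyOp S (q n) := by
    refine Metric.cauchySeq_iff.mpr fun ε hε => ?_
    obtain ⟨N, hN⟩ := exists_nat_one_div_lt (half_pos hε)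
    refine ⟨N, fun m hm n hn => ?_⟩
    rw [dist_eq_norm]
    have h1 := Nat.one_div_le_one_div (α := ℝ) hm
    have h2 := Nat.one_div_le_one_div (α := ℝ) hn
    linarith [hdist m n]
  obtain ⟨F, hF⟩ := cauchySeq_tendsto_of_complete hC
  refine ⟨F, isFunctionOf_iff.mpr fun ε hε => ?_⟩
  obtain ⟨N, hN⟩ := Metric.tendsto_atTop.mp hF ε hε
  obtain ⟨N', hN'⟩ := exists_nat_one_div_lt hε
  refine ⟨q (max N N'), fun t ht => (hq _ t ht).trans ?_, ?_⟩
  · exact (Nat.one_div_le_one_div (le_max_right N N')).trans hN'.le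
  · rw [← dist_eq_norm, dist_comm]
    exact (hN _ (le_max_left _ _)).le

theorem IsFunctionOf.norm_le {S : X →L[𝕜] X} (hS : IsSelfAdjoint S) {f : ℝ → ℝ} {F : X →L[𝕜] X}
    (hF : IsFunctionOf S f F) {C : ℝ} (hC : 0 ≤ C) (h : ∀ t ∈ realSpectrum S, |f t| ≤ C) :
    ‖F‖ ≤ C := by
  refine le_of_forall_pos_le_add fun ε hε => ?_
  obtain ⟨q, h1, h2⟩ := isFunctionOf_iff.mp hF (ε / 2) (half_pos hε)
  have h3 : ‖polyOp S q‖ ≤ C + ε / 2 := by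
    refine norm_polyOp_le hS q (by positivity) fun t ht => ?_
    have := abs_sub_abs_le_abs_sub (q.eval t) (f t)
    linarith [h1 t ht, h t ht]
  have := norm_sub_norm_le F (polyOp S q)
  linarith

theorem IsFunctionOf.unique {S : X →L[𝕜] X} (hS : IsSelfAdjoint S) {f : ℝ → ℝ} {F H : X →L[𝕜] X}
    (hF : IsFunctionOf S f F) (hH : IsFunctionOf S f H) : F = H := by
  have h := (hF.add (hH.const_mul (-1))).norm_le hS le_rfl (fun t _ => by simp)
  have h' := norm_le_zero_iff.mp h
  simpa [← sub_eq_add_neg, sub_eq_zero] using h'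

theorem opFun_spec {S : X →L[𝕜] X} (hS : IsSelfAdjoint S) {f : ℝ → ℝ}
    (hf : ContinuousOn f (realSpectrum S)) : IsFunctionOf S f (opFun S f) := by
  have h := exists_isFunctionOf hS hf
  rw [opFun, dif_pos h]
  exact h.choose_spec

theorem IsFunctionOf.opFun_eq {S : X →L[𝕜] X} (hS : IsSelfAdjoint S) {f : ℝ → ℝ} {F : X →L[𝕜] X}
    (hF : IsFunctionOf S f F) : opFun S f = F := by
  have h : ∃ F, IsFunctionOf S f F := ⟨F, hF⟩
  rw [opFun, dif_pos h]
  exact h.choose_spec.unique hS hF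

end FunctionalCalculus

/-! ### Algebra, order and spectra of the operators `f(S)`. -/

section OperatorFunctions

open Polynomial

variable {𝕜 X : Type*} [RCLike 𝕜] [NormedAddCommGroup X] [InnerProductSpace 𝕜 X] [CompleteSpace X]
  {S : X →L[𝕜] X} {f g : ℝ → ℝ}

theorem opFun_congr (hS : IsSelfAdjoint S) (hf : ContinuousOn f (realSpectrum S))
    (h : ∀ t ∈ realSpectrum S, f t = g t) : opFun S f = opFun S g :=
  (((opFun_spec hS hf).congr h).opFun_eq hS).symm

theorem opFun_add (hS : IsSelfAdjoint S) (hf : ContinuousOn f (realSpectrum S))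
    (hg : ContinuousOn g (realSpectrum S)) :
    opFun S (fun t => f t + g t) = opFun S f + opFun S g :=
  ((opFun_spec hS hf).add (opFun_spec hS hg)).opFun_eq hS

theorem opFun_const_mul (hS : IsSelfAdjoint S) (hf : ContinuousOn f (realSpectrum S)) (c : ℝ) :
    opFun S (fun t => c * f t) = (c : 𝕜) • opFun S f :=
  ((opFun_spec hS hf).const_mul c).opFun_eq hS

theorem opFun_mul (hS : IsSelfAdjoint S) (hf : ContinuousOn f (realSpectrum S))
    (hg : ContinuousOn g (realSpectrum S)) :
    opFun S (fun t => f t * g t) = opFun S f * opFun S g := by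
  obtain ⟨Cf, hCf⟩ := (isCompact_realSpectrum S).exists_bound_of_continuousOn hf
  obtain ⟨Cg, hCg⟩ := (isCompact_realSpectrum S).exists_bound_of_continuousOn hg
  exact ((opFun_spec hS hf).mul (opFun_spec hS hg) hCf hCg).opFun_eq hS

theorem opFun_eval (hS : IsSelfAdjoint S) (q : ℝ[X]) :
    opFun S (fun t => q.eval t) = polyOp S q :=
  (isFunctionOf_polyOp S q).opFun_eq hS

theorem opFun_const (hS : IsSelfAdjoint S) (c : ℝ) :
    opFun S (fun _ => c) = (c : 𝕜) • (1 : X →L[𝕜] X) := by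
  simpa using opFun_eval hS (C c)

theorem opFun_id (hS : IsSelfAdjoint S) : opFun S (fun t => t) = S := by
  simpa using opFun_eval hS Polynomial.X

theorem opFun_pow (hS : IsSelfAdjoint S) (n : ℕ) : opFun S (fun t => t ^ n) = S ^ n := by
  simpa using opFun_eval hS (Polynomial.X ^ n)

theorem opFun_sub (hS : IsSelfAdjoint S) (hf : ContinuousOn f (realSpectrum S))
    (hg : ContinuousOn g (realSpectrum S)) :
    opFun S (fun t => f t - g t) = opFun S f - opFun S g := by
  have h := opFun_add hS hf (hg.const_mul (-1))
  rw [opFun_const_mul hS hg] at h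
  simpa [sub_eq_add_neg] using h

theorem norm_opFun_le (hS : IsSelfAdjoint S) (hf : ContinuousOn f (realSpectrum S)) {C : ℝ}
    (hC : 0 ≤ C) (h : ∀ t ∈ realSpectrum S, |f t| ≤ C) : ‖opFun S f‖ ≤ C :=
  (opFun_spec hS hf).norm_le hS hC h

theorem norm_opFun_sub_le (hS : IsSelfAdjoint S) (hf : ContinuousOn f (realSpectrum S))
    (hg : ContinuousOn g (realSpectrum S)) {C : ℝ} (hC : 0 ≤ C)
    (h : ∀ t ∈ realSpectrum S, |f t - g t| ≤ C) : ‖opFun S f - opFun S g‖ ≤ C := by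
  rw [← opFun_sub hS hf hg]
  exact norm_opFun_le hS (hf.sub hg) hC h

theorem isSelfAdjoint_opFun (hS : IsSelfAdjoint S) (hf : ContinuousOn f (realSpectrum S)) :
    IsSelfAdjoint (opFun S f) := by
  rw [isSelfAdjoint_iff, ← sub_eq_zero, ← norm_le_zero_iff]
  refine le_of_forall_pos_le_add fun ε hε => ?_
  obtain ⟨q, -, h⟩ := isFunctionOf_iff.mp (opFun_spec hS hf) (ε / 2) (half_pos hε)
  have hq := isSelfAdjoint_polyOp hS q
  have h' : ‖star (opFun S f) - polyOp S q‖ ≤ ε / 2 := by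
    rw [← hq.star_eq, ← star_sub, norm_star]; exact h
  calc ‖star (opFun S f) - opFun S f‖
      = ‖(star (opFun S f) - polyOp S q) - (opFun S f - polyOp S q)‖ := by congr 1; abel
    _ ≤ 0 + ε := by linarith [norm_sub_le (star (opFun S f) - polyOp S q) (opFun S f - polyOp S q)]

theorem inner_comm_of_isSelfAdjoint {S : X →L[𝕜] X} (hS : IsSelfAdjoint S) (x y : X) :
    ⟪S x, y⟫_𝕜 = ⟪x, S y⟫_𝕜 := by
  rw [← ContinuousLinearMap.adjoint_inner_right, hS.adjoint_eq]

theorem norm_opFun_apply_sq (hS : IsSelfAdjoint S) (hf : ContinuousOn f (realSpectrum S)) (x : X) :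
    ‖opFun S f x‖ ^ 2 = RCLike.re ⟪opFun S (fun t => f t ^ 2) x, x⟫_𝕜 := by
  simp_rw [pow_two (f _)]
  rw [opFun_mul hS hf hf, mul_apply_eq_comp,
    inner_comm_of_isSelfAdjoint (isSelfAdjoint_opFun hS hf), inner_self_eq_norm_sq]

/-- Writing `f = (√f)²` on the spectrum turns the form into a squared norm. All order comparisons
below come from this. -/
theorem re_inner_opFun_nonneg (hS : IsSelfAdjoint S) (hf : ContinuousOn f (realSpectrum S))
    (h : ∀ t ∈ realSpectrum S, 0 ≤ f t) (x : X) : 0 ≤ RCLike.re ⟪opFun S f x, x⟫_𝕜 := by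
  have h1 : opFun S f = opFun S (fun t => √(f t) ^ 2) :=
    opFun_congr hS hf fun t ht => (Real.sq_sqrt (h t ht)).symm
  rw [h1, ← norm_opFun_apply_sq hS hf.sqrt]
  positivity

theorem re_inner_opFun_le (hS : IsSelfAdjoint S) (hf : ContinuousOn f (realSpectrum S))
    (hg : ContinuousOn g (realSpectrum S)) (h : ∀ t ∈ realSpectrum S, f t ≤ g t) (x : X) :
    RCLike.re ⟪opFun S f x, x⟫_𝕜 ≤ RCLike.re ⟪opFun S g x, x⟫_𝕜 := by
  have h1 := re_inner_opFun_nonneg hS (hg.sub hf) (fun t ht => sub_nonneg.mpr (h t ht)) x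
  change 0 ≤ RCLike.re ⟪opFun S (fun t => g t - f t) x, x⟫_𝕜 at h1
  rw [opFun_sub hS hg hf, sub_apply, inner_sub_left, map_sub] at h1
  linarith

theorem norm_opFun_apply_le (hS : IsSelfAdjoint S) (hf : ContinuousOn f (realSpectrum S))
    (hg : ContinuousOn g (realSpectrum S)) (h : ∀ t ∈ realSpectrum S, |f t| ≤ |g t|) (x : X) :
    ‖opFun S f x‖ ≤ ‖opFun S g x‖ := by
  refine (sq_le_sq₀ (norm_nonneg _) (norm_nonneg _)).mp ?_
  rw [norm_opFun_apply_sq hS hf, norm_opFun_apply_sq hS hg]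
  exact re_inner_opFun_le hS (hf.pow 2) (hg.pow 2) (fun t ht => sq_le_sq.mpr (h t ht)) x

theorem norm_opFun_apply_le_mul (hS : IsSelfAdjoint S) (hf : ContinuousOn f (realSpectrum S))
    (hg : ContinuousOn g (realSpectrum S)) {c : ℝ} (hc : 0 ≤ c)
    (h : ∀ t ∈ realSpectrum S, |f t| ≤ c * |g t|) (x : X) :
    ‖opFun S f x‖ ≤ c * ‖opFun S g x‖ := by
  have h1 := norm_opFun_apply_le hS hf (hg.const_mul c)
    (fun t ht => by simpa [abs_mul, abs_of_nonneg hc] using h t ht) x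
  change _ ≤ ‖opFun S (fun t => c * g t) x‖ at h1
  rwa [opFun_const_mul hS hg, smul_apply, norm_ofReal_smul, abs_of_nonneg hc] at h1

theorem opFun_apply_comm (hS : IsSelfAdjoint S) (hf : ContinuousOn f (realSpectrum S))
    (hg : ContinuousOn g (realSpectrum S)) (x : X) :
    opFun S f (opFun S g x) = opFun S g (opFun S f x) := by
  rw [← mul_apply_eq_comp, ← opFun_mul hS hf hg, ← mul_apply_eq_comp, ← opFun_mul hS hg hf]
  simp_rw [mul_comm]

/-- For nonreal `z` the imaginary part of the form of `S - z` has absolute value `|im z| ‖x‖²`,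
which makes `S - z` invertible. -/
theorem spectrum_subset_realSpectrum (hS : IsSelfAdjoint S) :
    spectrum 𝕜 S ⊆ (fun t : ℝ => (t : 𝕜)) '' realSpectrum S := by
  intro z hz
  by_cases him : RCLike.im z = 0
  · have hzr : ((RCLike.re z : ℝ) : 𝕜) = z :=
      RCLike.conj_eq_iff_re.mp (RCLike.conj_eq_iff_im.mpr him)
    exact ⟨RCLike.re z, by rw [realSpectrum, Set.mem_ofPred_eq, hzr]; exact hz, hzr⟩
  · exfalso
    rw [spectrum.mem_iff, IsUnit.sub_iff, Algebra.algebraMap_eq_smul_one] at hz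
    refine hz (ContinuousLinearMap.isUnit_of_forall_le_norm_inner_map _
      (c := ⟨|RCLike.im z|, abs_nonneg _⟩) (abs_pos.mpr him) fun x => ?_)
    change ‖x‖ ^ 2 * |RCLike.im z| ≤ _
    refine le_trans (le_of_eq ?_) (RCLike.abs_im_le_norm _)
    have h1 : RCLike.im ⟪S x, x⟫_𝕜 = 0 := by
      rw [← RCLike.conj_eq_iff_im, inner_conj_symm, inner_comm_of_isSelfAdjoint hS]
    rw [sub_apply, inner_sub_left, smul_apply, one_apply_eq_self, inner_smul_left,
      inner_self_eq_norm_sq_to_K, map_sub, h1, ← RCLike.ofReal_pow, RCLike.im_mul_ofReal,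
      RCLike.conj_im, zero_sub, neg_mul, neg_neg, abs_mul, abs_of_nonneg (sq_nonneg ‖x‖), mul_comm]

/-- If `f` omits `μ`, then `1 / (f - μ)` is continuous on the spectrum and its calculus value
inverts `f(S) - μ`. -/
theorem realSpectrum_opFun_subset (hS : IsSelfAdjoint S) (hf : ContinuousOn f (realSpectrum S)) :
    realSpectrum (opFun S f) ⊆ f '' realSpectrum S := by
  intro μ hμ
  by_contra hcon
  have hne : ∀ t ∈ realSpectrum S, f t - μ ≠ 0 := fun t ht h => hcon ⟨t, ht, sub_eq_zero.mp h⟩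
  have h1 : ContinuousOn (fun t => f t - μ) (realSpectrum S) := hf.sub continuousOn_const
  have h2 : ContinuousOn (fun t => (f t - μ)⁻¹) (realSpectrum S) := h1.inv₀ hne
  have e1 : opFun S (fun t => f t - μ) = opFun S f - (μ : 𝕜) • 1 := by
    rw [opFun_sub hS hf continuousOn_const, opFun_const hS]
  have e3 : opFun S (fun _ => (1 : ℝ)) = 1 := by rw [opFun_const hS]; simp
  have e2 : opFun S (fun t => f t - μ) * opFun S (fun t => (f t - μ)⁻¹) = 1 := by
    rw [← opFun_mul hS h1 h2, ← e3]
    exact opFun_congr hS (h1.mul h2) fun t ht => mul_inv_cancel₀ (hne t ht)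
  have e2' : opFun S (fun t => (f t - μ)⁻¹) * opFun S (fun t => f t - μ) = 1 := by
    rw [← opFun_mul hS h2 h1, ← e3]
    exact opFun_congr hS (h2.mul h1) fun t ht => inv_mul_cancel₀ (hne t ht)
  rw [mem_realSpectrum, ← e1] at hμ
  exact hμ ⟨⟨_, _, e2, e2'⟩, rfl⟩

theorem polyOp_opFun (hS : IsSelfAdjoint S) (hf : ContinuousOn f (realSpectrum S)) (q : ℝ[X]) :
    polyOp (opFun S f) q = opFun S (fun t => q.eval (f t)) := by
  have hc : ∀ q : ℝ[X], ContinuousOn (fun t => q.eval (f t)) (realSpectrum S) :=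
    fun q => q.continuous.comp_continuousOn hf
  induction q using Polynomial.induction_on with
  | C a => simp [opFun_const hS]
  | add p q hp hq =>
    simp only [map_add, eval_add]
    rw [opFun_add hS (hc p) (hc q), hp, hq]
  | monomial n a ih =>
    rw [pow_succ, ← mul_assoc, map_mul, ih, polyOp_X]
    simp only [eval_mul, eval_X (x := f _)]
    have h1 := opFun_mul hS (hc (C a * Polynomial.X ^ n)) hf
    simp only [eval_mul] at h1
    rw [h1]

theorem opFun_opFun (hS : IsSelfAdjoint S) (hf : ContinuousOn f (realSpectrum S))
    (hg : ContinuousOn g (f '' realSpectrum S)) :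
    opFun (opFun S f) g = opFun S (fun t => g (f t)) := by
  refine IsFunctionOf.opFun_eq (isSelfAdjoint_opFun hS hf) (isFunctionOf_iff.mpr fun ε hε => ?_)
  obtain ⟨q, hq⟩ := exists_polynomial_near ((isCompact_realSpectrum S).image_of_continuousOn hf)
    hg hε
  refine ⟨q, fun t ht => hq t (realSpectrum_opFun_subset hS hf ht), ?_⟩
  rw [polyOp_opFun hS hf]
  refine norm_opFun_sub_le hS (hg.comp hf (Set.mapsTo_image _ _))
    (q.continuous.comp_continuousOn hf) hε.le fun t ht => ?_
  rw [abs_sub_comm]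
  exact hq _ ⟨t, ht, rfl⟩

theorem realSpectrum_nonneg (hS : S.IsPositive) {t : ℝ} (ht : t ∈ realSpectrum S) : 0 ≤ t := by
  by_contra! hneg
  rw [mem_realSpectrum] at ht
  refine ht (ContinuousLinearMap.isUnit_of_forall_le_norm_inner_map _
    (c := ⟨-t, by linarith⟩) (by change 0 < -t; linarith) fun x => ?_)
  change ‖x‖ ^ 2 * (-t) ≤ _
  refine le_trans ?_ (RCLike.re_le_norm _)
  have := hS.re_inner_nonneg_left x
  rw [sub_apply, inner_sub_left, smul_apply, one_apply_eq_self, inner_smul_left, map_sub,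
    RCLike.conj_ofReal, RCLike.re_ofReal_mul, inner_self_eq_norm_sq]
  linarith

theorem realSpectrum_subset_Icc (hS : S.IsPositive) : realSpectrum S ⊆ Set.Icc 0 ‖S‖ :=
  fun _ ht => ⟨realSpectrum_nonneg hS ht, (le_abs_self _).trans (abs_le_of_mem_realSpectrum ht)⟩

theorem exists_approx_eigenvector (hS : IsSelfAdjoint S) {t : ℝ} (ht : t ∈ realSpectrum S) {η : ℝ}
    (hη : 0 < η) : ∃ v : X, ‖v‖ = 1 ∧ ‖S v - (t : 𝕜) • v‖ ≤ η := by
  by_contra! hcon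
  rw [mem_realSpectrum] at ht
  have hV : IsSelfAdjoint (S - (t : 𝕜) • (1 : X →L[𝕜] X)) := by
    refine hS.sub (IsSelfAdjoint.smul ?_ (IsSelfAdjoint.one _))
    simp [isSelfAdjoint_iff]
  have hb : ∀ x : X, η * ‖x‖ ≤ ‖(S - (t : 𝕜) • (1 : X →L[𝕜] X)) x‖ := by
    intro x
    by_cases hx : x = 0
    · simp [hx]
    have hx' : 0 < ‖x‖ := norm_pos_iff.mpr hx
    have h := hcon (((‖x‖⁻¹ : ℝ) : 𝕜) • x) (by
      rw [norm_ofReal_smul, abs_of_pos (inv_pos.mpr hx'), inv_mul_cancel₀ hx'.ne'])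
    rw [map_smul, smul_comm, ← smul_sub, norm_ofReal_smul, abs_of_pos (inv_pos.mpr hx'),
      inv_mul_eq_div, lt_div_iff₀ hx'] at h
    simpa using h.le
  set V := S - (t : 𝕜) • (1 : X →L[𝕜] X)
  refine ht ((Commute.refl V).isUnit_mul_iff.mp ?_).1
  refine ContinuousLinearMap.isUnit_of_forall_le_norm_inner_map _
    (c := ⟨η ^ 2, sq_nonneg η⟩) (by change 0 < η ^ 2; positivity) fun x => ?_
  change ‖x‖ ^ 2 * η ^ 2 ≤ _
  refine le_trans ?_ (RCLike.re_le_norm _)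
  rw [mul_apply_eq_comp, inner_comm_of_isSelfAdjoint hV, inner_self_eq_norm_sq, ← mul_pow, mul_comm]
  exact pow_le_pow_left₀ (by positivity) (hb x) 2

/-- Approximate eigenvectors of `S` serve `f(S)` as well: for a polynomial `q` near `f`, the
difference `q(S) - q(t)` is divisible by `S - t`. -/
theorem exists_opFun_approx (hS : IsSelfAdjoint S) (hf : ContinuousOn f (realSpectrum S)) {t : ℝ}
    (ht : t ∈ realSpectrum S) {ε : ℝ} (hε : 0 < ε) :
    ∃ η > 0, ∀ v : X, ‖v‖ = 1 → ‖S v - (t : 𝕜) • v‖ ≤ η →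
      ‖opFun S f v - (f t : 𝕜) • v‖ ≤ ε := by
  obtain ⟨q, h1, h2⟩ := isFunctionOf_iff.mp (opFun_spec hS hf) (ε / 3) (by positivity)
  obtain ⟨r, hr⟩ : (Polynomial.X - C t) ∣ q - C (q.eval t) := dvd_iff_isRoot.mpr (by simp)
  have hr' : polyOp S q - ((q.eval t : ℝ) : 𝕜) • 1 = polyOp S r * (S - (t : 𝕜) • 1) := by
    have := congrArg (polyOp S) hr
    rwa [mul_comm, map_mul, map_sub, map_sub, polyOp_C, polyOp_C, polyOp_X] at this
  refine ⟨ε / 3 / (‖polyOp S r‖ + 1), by positivity, fun v hv hη => ?_⟩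
  have a1 : ‖(opFun S f - polyOp S q) v‖ ≤ ε / 3 := by
    have := (opFun S f - polyOp S q).le_opNorm v
    rw [hv, mul_one] at this
    exact this.trans h2
  have a2 : ‖(polyOp S q - ((q.eval t : ℝ) : 𝕜) • (1 : X →L[𝕜] X)) v‖ ≤ ε / 3 := by
    rw [hr', mul_apply_eq_comp]
    have h3 := (polyOp S r).le_opNorm ((S - (t : 𝕜) • (1 : X →L[𝕜] X)) v)
    have h4 : ‖(S - (t : 𝕜) • (1 : X →L[𝕜] X)) v‖ ≤ ε / 3 / (‖polyOp S r‖ + 1) := by simpa using hη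
    rw [le_div_iff₀ (by positivity)] at h4
    nlinarith [norm_nonneg ((S - (t : 𝕜) • (1 : X →L[𝕜] X)) v)]
  have a3 : ‖((q.eval t - f t : ℝ) : 𝕜) • v‖ ≤ ε / 3 := by
    rw [norm_ofReal_smul, hv, mul_one]; exact h1 t ht
  have e : opFun S f v - (f t : 𝕜) • v = (opFun S f - polyOp S q) v
      + (polyOp S q - ((q.eval t : ℝ) : 𝕜) • (1 : X →L[𝕜] X)) v
      + ((q.eval t - f t : ℝ) : 𝕜) • v := by
    simp only [sub_apply, smul_apply, one_apply_eq_self, RCLike.ofReal_sub, sub_smul]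
    abel
  rw [e]
  exact norm_add₃_le.trans (by linarith)

end OperatorFunctions

/-! ### Factorization through operators with dense range. -/

section Factorization

variable {𝕜 X Y : Type*} [RCLike 𝕜]
  [NormedAddCommGroup X] [InnerProductSpace 𝕜 X]
  [NormedAddCommGroup Y] [InnerProductSpace 𝕜 Y] [CompleteSpace Y]

theorem exists_factor {Q : X →L[𝕜] X} (hQ : DenseRange Q) (A : X →L[𝕜] Y) {C : ℝ}
    (h : ∀ x, ‖A x‖ ≤ C * ‖Q x‖) :
    ∃ T : X →L[𝕜] Y, (∀ x, T (Q x) = A x) ∧ ∀ x, ‖T x‖ ≤ C * ‖x‖ :=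
  ⟨LinearMap.extendOfNorm (A : X →ₗ[𝕜] Y) (Q : X →ₗ[𝕜] X),
    fun x => LinearMap.extendOfNorm_eq (f := (A : X →ₗ[𝕜] Y)) (e := (Q : X →ₗ[𝕜] X)) hQ ⟨C, h⟩ x,
    LinearMap.norm_extendOfNorm_apply_le hQ C h⟩

variable [CompleteSpace X]

/-- Range membership by duality: `Q u ↦ ⟪w, u⟫` extends to a functional of norm at most `K`, and its
Riesz representative is the preimage of `w`. -/
theorem exists_preimage_of_inner_le {Q : X →L[𝕜] X} (hS : IsSelfAdjoint Q) (hQ : DenseRange Q)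
    {w : X} {K : ℝ} (hK : 0 ≤ K) (h : ∀ u, ‖⟪w, u⟫_𝕜‖ ≤ K * ‖Q u‖) :
    ∃ v : X, ‖v‖ ≤ K ∧ Q v = w := by
  obtain ⟨T, hT, hTn⟩ := exists_factor hQ (innerSL 𝕜 w) h
  refine ⟨(InnerProductSpace.toDual 𝕜 X).symm T, ?_, ?_⟩
  · rw [LinearIsometryEquiv.norm_map]
    exact T.opNorm_le_bound hK hTn
  · refine ext_inner_right 𝕜 fun u => ?_
    rw [inner_comm_of_isSelfAdjoint hS, InnerProductSpace.toDual_symm_apply, hT]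
    rfl

theorem denseRange_of_injective {Q : X →L[𝕜] X} (hS : IsSelfAdjoint Q)
    (hQ : Function.Injective Q) : DenseRange Q := by
  have h := ContinuousLinearMap.orthogonal_range Q
  rw [hS.adjoint_eq, LinearMap.ker_eq_bot.mpr hQ] at h
  have := (Submodule.topologicalClosure_eq_top_iff (K := LinearMap.range (Q : X →ₗ[𝕜] X))).mpr h
  rw [← Submodule.dense_iff_topologicalClosure_eq_top] at this
  exact this

end Factorization

/-! ### Nonnegative powers of `G`. -/

section Powers

variable {𝕜 X : Type*} [RCLike 𝕜] [NormedAddCommGroup X] [InnerProductSpace 𝕜 X] [CompleteSpace X]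
  {G : X →L[𝕜] X}

theorem continuous_rpow_of_nonneg {r : ℝ} (hr : 0 ≤ r) : Continuous fun t : ℝ => t ^ r :=
  continuous_iff_continuousAt.mpr fun _ => Real.continuousAt_rpow_const _ _ (Or.inr hr)

theorem isSelfAdjoint_opPow (hG : G.IsPositive) {r : ℝ} (hr : 0 ≤ r) : IsSelfAdjoint (opPow G r) :=
  isSelfAdjoint_opFun hG.isSelfAdjoint (continuous_rpow_of_nonneg hr).continuousOn

theorem opPow_add (hG : G.IsPositive) {p q : ℝ} (hp : 0 ≤ p) (hq : 0 ≤ q) (x : X) :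
    opPow G (p + q) x = opPow G p (opPow G q x) := by
  have hc := fun {r : ℝ} (hr : 0 ≤ r) =>
    (continuous_rpow_of_nonneg hr).continuousOn (s := realSpectrum G)
  rw [opPow, opPow, opPow, ← mul_apply_eq_comp, ← opFun_mul hG.isSelfAdjoint (hc hp) (hc hq)]
  congr 1
  exact opFun_congr hG.isSelfAdjoint (hc (add_nonneg hp hq))
    fun t ht => Real.rpow_add_of_nonneg (realSpectrum_nonneg hG ht) hp hq

/-- For an integer `n ≥ r`, `G^(n-r) G^r = G^n` is injective, hence so is the right factor. -/
theorem opPow_injective (hG : G.IsPositive) (hinj : Function.Injective G) {r : ℝ} (hr : 0 ≤ r) :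
    Function.Injective (opPow G r) := by
  obtain ⟨n, hn⟩ := exists_nat_ge r
  have h : (fun x => opPow G (n - r) (opPow G r x)) = (G : X → X)^[n] := by
    funext x
    rw [← opPow_add hG (sub_nonneg.mpr hn) hr, sub_add_cancel, opPow]
    simp_rw [Real.rpow_natCast]
    rw [opFun_pow hG.isSelfAdjoint, FunLike.coe_pow_eq_iterate]
  refine Function.Injective.of_comp (f := opPow G (n - r)) ?_
  rw [Function.comp_def, h]
  exact hinj.iterate n

theorem denseRange_opPow (hG : G.IsPositive) (hinj : Function.Injective G) {r : ℝ} (hr : 0 ≤ r) :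
    DenseRange (opPow G r) :=
  denseRange_of_injective (isSelfAdjoint_opPow hG hr) (opPow_injective hG hinj hr)

theorem opFun_opPow (hG : G.IsPositive) {f g : ℝ → ℝ} {r : ℝ} (hr : 0 ≤ r)
    (hf : ContinuousOn f (Set.Icc 0 ‖G‖)) (h : ∀ t ∈ Set.Icc 0 ‖G‖, f t * t ^ r = g t) (x : X) :
    opFun G f (opPow G r x) = opFun G g x := by
  have hc := (continuous_rpow_of_nonneg hr).continuousOn (s := realSpectrum G)
  have hf' := hf.mono (realSpectrum_subset_Icc hG)
  rw [opPow, ← mul_apply_eq_comp, ← opFun_mul hG.isSelfAdjoint hf' hc]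
  congr 1
  exact opFun_congr hG.isSelfAdjoint (hf'.mul hc) fun t ht => h t (realSpectrum_subset_Icc hG ht)

end Powers

/-! ### Operator monotonicity up to the boundary point 0. -/

section Monotone

variable {𝕜 X : Type*} [RCLike 𝕜] [NormedAddCommGroup X] [InnerProductSpace 𝕜 X] [CompleteSpace X]

theorem re_inner_opFun_add_const {S : X →L[𝕜] X} (hS : IsSelfAdjoint S) {f : ℝ → ℝ}
    (hf : ContinuousOn f (realSpectrum S)) (c : ℝ) (x : X) :
    RCLike.re ⟪opFun S (fun t => f t + c) x, x⟫_𝕜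
      = RCLike.re ⟪opFun S f x, x⟫_𝕜 + c * ‖x‖ ^ 2 := by
  rw [opFun_add hS hf continuousOn_const, opFun_const hS, add_apply, inner_add_left, map_add,
    smul_apply, one_apply_eq_self, inner_smul_left, RCLike.conj_ofReal, RCLike.re_ofReal_mul,
    inner_self_eq_norm_sq]

/-- An operator monotone function on `(0, b]` that is continuous on `[0, b]` is also monotone
for positive operators that are not necessarily invertible. -/
theorem OperatorMonotone.re_inner_le {b : ℝ} (hb : 0 < b) {f : ℝ → ℝ}
    (hmon : OperatorMonotone 𝕜 X b f) (hf : ContinuousOn f (Set.Icc 0 b)) {S₁ S₂ : X →L[𝕜] X}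
    (h₁ : S₁.IsPositive) (h₂ : S₂.IsPositive) (n₁ : ‖S₁‖ ≤ b) (n₂ : ‖S₂‖ ≤ b) (hle : S₁ ≤ S₂)
    (x : X) : RCLike.re ⟪opFun S₁ f x, x⟫_𝕜 ≤ RCLike.re ⟪opFun S₂ f x, x⟫_𝕜 := by
  have huc := isCompact_Icc.uniformContinuousOn_of_continuous hf
  have main : ∀ ε > 0, RCLike.re ⟪opFun S₁ f x, x⟫_𝕜
      ≤ RCLike.re ⟪opFun S₂ f x, x⟫_𝕜 + ε * (2 * ‖x‖ ^ 2) := by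
    intro ε hε
    obtain ⟨δ, hδ, hu⟩ := Metric.uniformContinuousOn_iff.mp huc ε hε
    obtain ⟨θ, hθ0, hθ1, hθδ⟩ : ∃ θ : ℝ, 0 < θ ∧ θ ≤ 1 ∧ θ * b < δ := by
      refine ⟨min 1 (δ / (2 * b)), lt_min one_pos (by positivity), min_le_left _ _, ?_⟩
      have := (le_div_iff₀ (by positivity)).mp (min_le_right 1 (δ / (2 * b)))
      linarith
    -- This affine map preserves the operator order and sends `[0, b]` into `[θ b, b]`, where the
    -- hypothesis applies. It moves points by at most `θ b < δ`, so `f` changes by at most `ε`.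
    set j : ℝ → ℝ := fun t => (1 - θ) * t + θ * b
    have hj : Continuous j := by fun_prop
    have hjI : ∀ t ∈ Set.Icc 0 b, j t ∈ Set.Icc (θ * b) b := fun t ht =>
      ⟨le_add_of_nonneg_left (mul_nonneg (by linarith) ht.1), by
        have := mul_le_mul_of_nonneg_left ht.2 (sub_nonneg.mpr hθ1)
        simp only [j]; linarith⟩
    have hθb : 0 < θ * b := mul_pos hθ0 hb
    have hjI' : ∀ t ∈ Set.Icc 0 b, j t ∈ Set.Icc 0 b :=
      fun t ht => ⟨hθb.le.trans (hjI t ht).1, (hjI t ht).2⟩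
    have hclose : ∀ t ∈ Set.Icc 0 b, |f (j t) - f t| ≤ ε := by
      intro t ht
      refine (hu (j t) (hjI' t ht) t ht ?_).le
      have e : j t - t = θ * (b - t) := by simp only [j]; ring
      rw [Real.dist_eq, e, abs_of_nonneg (mul_nonneg hθ0.le (sub_nonneg.mpr ht.2))]
      exact lt_of_le_of_lt (mul_le_mul_of_nonneg_left (by linarith [ht.1]) hθ0.le) hθδ
    have hI : ∀ {S : X →L[𝕜] X}, S.IsPositive → ‖S‖ ≤ b → realSpectrum S ⊆ Set.Icc 0 b :=
      fun hS hn => (realSpectrum_subset_Icc hS).trans (Set.Icc_subset_Icc_right hn)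
    have hsp : ∀ {S : X →L[𝕜] X}, S.IsPositive → ‖S‖ ≤ b →
        spectrum 𝕜 (opFun S j) ⊆ (fun t : ℝ => (t : 𝕜)) '' Set.Ioc 0 b := by
      intro S hS hn
      refine (spectrum_subset_realSpectrum
        (isSelfAdjoint_opFun hS.isSelfAdjoint hj.continuousOn)).trans (Set.image_mono ?_)
      refine (realSpectrum_opFun_subset hS.isSelfAdjoint hj.continuousOn).trans ?_
      rintro _ ⟨t, ht, rfl⟩
      exact ⟨hθb.trans_le (hjI t (hI hS hn ht)).1, (hjI t (hI hS hn ht)).2⟩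
    have hfj : ContinuousOn (fun t => f (j t)) (Set.Icc 0 b) := hf.comp hj.continuousOn hjI'
    have hcomp : ∀ {S : X →L[𝕜] X}, S.IsPositive → ‖S‖ ≤ b →
        opFun (opFun S j) f = opFun S (fun t => f (j t)) := by
      intro S hS hn
      refine opFun_opFun hS.isSelfAdjoint hj.continuousOn (hf.mono ?_)
      rintro _ ⟨t, ht, rfl⟩
      exact hjI' t (hI hS hn ht)
    have hj_eq : ∀ {S : X →L[𝕜] X}, IsSelfAdjoint S →
        opFun S j = ((1 - θ : ℝ) : 𝕜) • S + ((θ * b : ℝ) : 𝕜) • 1 := by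
      intro S hS
      have h1 := opFun_const_mul hS (f := fun t => t) continuousOn_id (1 - θ)
      have h2 := opFun_add hS (f := fun t => (1 - θ) * t) (g := fun _ => θ * b) (by fun_prop)
        continuousOn_const
      rw [h1, opFun_id hS, opFun_const hS] at h2
      exact h2
    have hle' : opFun S₁ j ≤ opFun S₂ j := by
      rw [ContinuousLinearMap.le_def, hj_eq h₁.isSelfAdjoint, hj_eq h₂.isSelfAdjoint,
        add_sub_add_right_eq_sub, ← smul_sub]
      refine ContinuousLinearMap.IsPositive.smul_of_nonneg hle ?_
      exact RCLike.ofReal_nonneg.mpr (by linarith)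
    have key := hmon _ _ (isSelfAdjoint_opFun h₁.isSelfAdjoint hj.continuousOn)
      (isSelfAdjoint_opFun h₂.isSelfAdjoint hj.continuousOn) (hsp h₁ n₁) (hsp h₂ n₂) hle'
    rw [hcomp h₁ n₁, hcomp h₂ n₂, ContinuousLinearMap.le_def] at key
    have k1 := key.re_inner_nonneg_left x
    rw [sub_apply, inner_sub_left, map_sub] at k1
    have c₁ := hI h₁ n₁
    have c₂ := hI h₂ n₂
    have k2 := re_inner_opFun_le h₁.isSelfAdjoint (g := fun t => f (j t) + ε) (hf.mono c₁)
      ((hfj.add continuousOn_const).mono c₁)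
      (fun t ht => by linarith [(abs_le.mp (hclose t (c₁ ht))).1] :
        ∀ t ∈ realSpectrum S₁, f t ≤ f (j t) + ε) x
    have k3 := re_inner_opFun_le h₂.isSelfAdjoint (g := fun t => f t + ε) (hfj.mono c₂)
      ((hf.add continuousOn_const).mono c₂)
      (fun t ht => by linarith [(abs_le.mp (hclose t (c₂ ht))).2] :
        ∀ t ∈ realSpectrum S₂, f (j t) ≤ f t + ε) x
    rw [re_inner_opFun_add_const h₁.isSelfAdjoint (hfj.mono c₁)] at k2
    rw [re_inner_opFun_add_const h₂.isSelfAdjoint (hf.mono c₂)] at k3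
    linarith
  refine le_of_forall_pos_le_add fun ε hε => ?_
  refine (main (ε / (2 * ‖x‖ ^ 2 + 1)) (by positivity)).trans ?_
  gcongr
  rw [div_mul_eq_mul_div, div_le_iff₀ (by positivity)]
  nlinarith

end Monotone

/-! ### Scalar residual and filter functions of the iteration. -/

section Residual

/-- The residual polynomial factor `∏ α k / (t + α k)` of the implicit iteration. -/
def residFun (α : ℕ → ℝ) : ℕ → ℝ → ℝ
  | 0, _ => 1
  | n + 1, t => α (n + 1) * residFun α n t / (t + α (n + 1))

/-- The filter function `(1 - residFun α n t) / t` of the implicit iteration. -/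
def filterFun (α : ℕ → ℝ) : ℕ → ℝ → ℝ
  | 0, _ => 0
  | n + 1, t => (α (n + 1) * filterFun α n t + 1) / (t + α (n + 1))

/-- The sum of the inverse regularization parameters. -/
def invSum (α : ℕ → ℝ) (n : ℕ) : ℝ := ∑ k ∈ Finset.range n, 1 / α (k + 1)

variable {α : ℕ → ℝ} {n : ℕ}

theorem pos_of_succ (hα : ∀ k ∈ Finset.Icc 1 (n + 1), 0 < α k) :
    0 < α (n + 1) ∧ ∀ k ∈ Finset.Icc 1 n, 0 < α k :=
  ⟨hα _ (by simp), fun k hk => hα k (by rw [Finset.mem_Icc] at hk ⊢; omega)⟩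

theorem continuousOn_residFun (hα : ∀ k ∈ Finset.Icc 1 n, 0 < α k) :
    ContinuousOn (residFun α n) (Set.Ici 0) := by
  induction n with
  | zero => exact continuousOn_const
  | succ n ih =>
    obtain ⟨h0, h1⟩ := pos_of_succ hα
    refine ((ih h1).const_mul _).div (by fun_prop) fun t ht => ?_
    have : 0 ≤ t := ht
    positivity

theorem continuousOn_filterFun (hα : ∀ k ∈ Finset.Icc 1 n, 0 < α k) :
    ContinuousOn (filterFun α n) (Set.Ici 0) := by
  induction n with
  | zero => exact continuousOn_const
  | succ n ih =>
    obtain ⟨h0, h1⟩ := pos_of_succ hα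
    refine (((ih h1).const_mul _).add continuousOn_const).div (by fun_prop) fun t ht => ?_
    have : 0 ≤ t := ht
    positivity

theorem invSum_nonneg (hα : ∀ k ∈ Finset.Icc 1 n, 0 < α k) : 0 ≤ invSum α n := by
  refine Finset.sum_nonneg fun k hk => ?_
  have := hα (k + 1) (by rw [Finset.mem_range] at hk; rw [Finset.mem_Icc]; omega)
  positivity

theorem residFun_nonneg (hα : ∀ k ∈ Finset.Icc 1 n, 0 < α k) {t : ℝ} (ht : 0 ≤ t) :
    0 ≤ residFun α n t := by
  induction n with
  | zero => exact zero_le_one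
  | succ n ih =>
    obtain ⟨h0, h1⟩ := pos_of_succ hα
    have := ih h1
    rw [residFun]
    positivity

theorem filterFun_nonneg (hα : ∀ k ∈ Finset.Icc 1 n, 0 < α k) {t : ℝ} (ht : 0 ≤ t) :
    0 ≤ filterFun α n t := by
  induction n with
  | zero => exact le_rfl
  | succ n ih =>
    obtain ⟨h0, h1⟩ := pos_of_succ hα
    have := ih h1
    rw [filterFun]
    positivity

theorem mul_filterFun (hα : ∀ k ∈ Finset.Icc 1 n, 0 < α k) {t : ℝ} (ht : 0 ≤ t) :
    t * filterFun α n t = 1 - residFun α n t := by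
  induction n with
  | zero => simp [filterFun, residFun]
  | succ n ih =>
    obtain ⟨h0, h1⟩ := pos_of_succ hα
    have h := ih h1
    have h2 : t + α (n + 1) ≠ 0 := by positivity
    rw [filterFun, residFun]
    field_simp
    linear_combination α (n + 1) * h

/-- The reciprocal of the residual is `∏ (1 + t / α k)`, and expanding the product leaves at least
`1 + t ∑ 1 / α k`. -/
theorem residFun_mul_le (hα : ∀ k ∈ Finset.Icc 1 n, 0 < α k) {t : ℝ} (ht : 0 ≤ t) :
    residFun α n t * (1 + invSum α n * t) ≤ 1 := by
  induction n with
  | zero => simp [residFun, invSum]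
  | succ n ih =>
    obtain ⟨h0, h1⟩ := pos_of_succ hα
    have h := ih h1
    have h2 : 0 < t + α (n + 1) := by positivity
    have h3 := residFun_nonneg h1 ht
    have h4 : residFun α n t ≤ 1 := by
      have := mul_nonneg h3 (mul_nonneg (invSum_nonneg h1) ht)
      linarith
    rw [residFun, invSum, Finset.sum_range_succ, ← invSum, div_mul_eq_mul_div, div_le_one h2]
    have e : α (n + 1) * residFun α n t * (1 + (invSum α n + 1 / α (n + 1)) * t)
        = α (n + 1) * (residFun α n t * (1 + invSum α n * t)) + residFun α n t * t := by
      field_simp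
      ring
    rw [e]
    nlinarith

theorem residFun_le_one (hα : ∀ k ∈ Finset.Icc 1 n, 0 < α k) {t : ℝ} (ht : 0 ≤ t) :
    residFun α n t ≤ 1 := by
  have h := mul_nonneg (residFun_nonneg hα ht) (mul_nonneg (invSum_nonneg hα) ht)
  linarith [residFun_mul_le hα ht]

theorem mul_filterFun_le_one (hα : ∀ k ∈ Finset.Icc 1 n, 0 < α k) {t : ℝ} (ht : 0 ≤ t) :
    t * filterFun α n t ≤ 1 := by
  linarith [mul_filterFun hα ht, residFun_nonneg hα ht]

/-- The bound is the value of the filter at `t = 0`. -/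
theorem filterFun_le (hα : ∀ k ∈ Finset.Icc 1 n, 0 < α k) {t : ℝ} (ht : 0 ≤ t) :
    filterFun α n t ≤ invSum α n := by
  induction n with
  | zero => simp [filterFun, invSum]
  | succ n ih =>
    obtain ⟨h0, h1⟩ := pos_of_succ hα
    have h := ih h1
    have hg := filterFun_nonneg h1 ht
    rw [filterFun, invSum, Finset.sum_range_succ, ← invSum, div_le_iff₀ (by positivity)]
    have e : (invSum α n + 1 / α (n + 1)) * (t + α (n + 1))
        = α (n + 1) * invSum α n + 1 + (invSum α n + 1 / α (n + 1)) * t := by field_simp; ring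
    rw [e]
    have := mul_nonneg (add_nonneg (invSum_nonneg h1) (one_div_pos.mpr h0).le) ht
    nlinarith

/-- A nonnegative increasing function `φ` on `[0, B]` such that `φ(t) / √t` is decreasing. -/
structure IsLinkFunction (B : ℝ) (φ : ℝ → ℝ) : Prop where
  pos_right : 0 < B
  continuousOn : ContinuousOn φ (Set.Icc 0 B)
  nonneg : ∀ t ∈ Set.Icc 0 B, 0 ≤ φ t
  pos : ∀ t ∈ Set.Ioc 0 B, 0 < φ t
  monotoneOn : MonotoneOn φ (Set.Icc 0 B)
  antitoneOn : AntitoneOn (fun t => φ t / √t) (Set.Ioc 0 B)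

theorem IsLinkFunction.sqrt_mul_le {B : ℝ} {φ : ℝ → ℝ} (h : IsLinkFunction B φ) {t t' : ℝ}
    (ht : 0 ≤ t) (ht' : t' ∈ Set.Ioc 0 B) (htt : t ≤ t') : √t * φ t' ≤ √t' * φ t := by
  rcases ht.eq_or_lt with rfl | hpos
  · simpa using mul_nonneg (Real.sqrt_nonneg t') (h.nonneg 0 ⟨le_rfl, h.pos_right.le⟩)
  · have := h.antitoneOn ⟨hpos, htt.trans ht'.2⟩ ht' htt
    have h1 : 0 < √t := Real.sqrt_pos.mpr hpos
    have h2 : 0 < √t' := Real.sqrt_pos.mpr ht'.1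
    simp only [] at this
    rw [div_le_div_iff₀ h2 h1] at this
    linarith

/-- For `σ > 0` this is `l = min(B, 1/σ)`; for `σ = 0` (no iteration steps) it is `l = B`. Equality
`σ l = 1` is needed only if some admissible `t` lies above `l`. -/
theorem exists_cutoff {B σ : ℝ} (hB : 0 < B) : ∃ l ∈ Set.Ioc 0 B, σ * l ≤ 1 ∧
    ∀ t ∈ Set.Icc 0 B, l < t → σ * l = 1 := by
  by_cases h : σ * B ≤ 1
  · exact ⟨B, ⟨hB, le_rfl⟩, h, fun t ht hlt => absurd ht.2 hlt.not_ge⟩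
  · push Not at h
    have hσ : 0 < σ := by
      by_contra! hσ
      linarith [mul_nonpos_of_nonpos_of_nonneg hσ hB.le]
    have e : σ * (1 / σ) = 1 := by field_simp
    refine ⟨1 / σ, ⟨by positivity, ?_⟩, e.le, fun _ _ _ => e⟩
    rw [div_le_iff₀ hσ]
    linarith

/-- The scalar estimates behind the error bound, all in terms of one cut-off value `l`. -/
theorem filter_residual_bounds {B : ℝ} {φ : ℝ → ℝ} (hφ : IsLinkFunction B φ)
    (hα : ∀ k ∈ Finset.Icc 1 n, 0 < α k) {l : ℝ} (hl : l ∈ Set.Ioc 0 B)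
    (hl1 : ∀ t ∈ Set.Icc 0 B, l < t → invSum α n * l = 1) {t : ℝ} (ht : t ∈ Set.Icc 0 B) :
    √t * filterFun α n t ≤ invSum α n * √l / φ l * φ t ∧
    √t * (residFun α n t * φ t) ≤ √l * φ l ∧
    √t * (filterFun α n t * φ t) ≤ invSum α n * √l * φ l ∧
    √t * residFun α n t ≤ √l / φ l * φ t := by
  set σ := invSum α n
  set g := filterFun α n t
  set r := residFun α n t
  have hσ : 0 ≤ σ := invSum_nonneg hα
  have hg : 0 ≤ g := filterFun_nonneg hα ht.1
  have hgσ : g ≤ σ := filterFun_le hα ht.1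
  have htg : t * g ≤ 1 := mul_filterFun_le_one hα ht.1
  have hr : 0 ≤ r := residFun_nonneg hα ht.1
  have hr1 : r ≤ 1 := residFun_le_one hα ht.1
  have hrσ : r * (1 + σ * t) ≤ 1 := residFun_mul_le hα ht.1
  have hP : 0 < φ l := hφ.pos l hl
  have hφt : 0 ≤ φ t := hφ.nonneg t ht
  have hs : 0 ≤ √t := Real.sqrt_nonneg t
  have hsl : 0 < √l := Real.sqrt_pos.mpr hl.1
  have hss : √t * √t = t := Real.mul_self_sqrt ht.1
  have hssl : √l * √l = l := Real.mul_self_sqrt hl.1.le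
  suffices h : √t * g * φ l ≤ σ * √l * φ t ∧ √t * r * φ t ≤ √l * φ l ∧
      √t * g * φ t ≤ σ * √l * φ l ∧ √t * r * φ l ≤ √l * φ t by
    obtain ⟨h1, h2, h3, h4⟩ := h
    refine ⟨?_, by linarith, by linarith, ?_⟩
    · rw [div_mul_eq_mul_div, le_div_iff₀ hP]; exact h1
    · rw [div_mul_eq_mul_div, le_div_iff₀ hP]; exact h4
  -- Below the cut-off use `g ≤ σ` and `r ≤ 1`; above it use `t g ≤ 1` and `r t ≤ 1/σ = l`. The two
  -- monotonicity properties of `φ` move between `φ t` and `φ l`.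
  rcases le_or_gt t l with htl | htl
  · have m1 : φ t ≤ φ l := hφ.monotoneOn ht ⟨hl.1.le, hl.2⟩ htl
    have m2 : √t * φ l ≤ √l * φ t := hφ.sqrt_mul_le ht.1 hl htl
    have m3 : √t ≤ √l := Real.sqrt_le_sqrt htl
    have m4 : √t * φ t ≤ √l * φ l := mul_le_mul m3 m1 hφt hsl.le
    refine ⟨?_, ?_, ?_, ?_⟩
    · calc √t * g * φ l = g * (√t * φ l) := by ring
        _ ≤ σ * (√l * φ t) := mul_le_mul hgσ m2 (by positivity) hσ
        _ = _ := by ring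
    · calc √t * r * φ t = r * (√t * φ t) := by ring
        _ ≤ 1 * (√l * φ l) := mul_le_mul hr1 m4 (by positivity) zero_le_one
        _ = _ := by ring
    · calc √t * g * φ t = g * (√t * φ t) := by ring
        _ ≤ σ * (√l * φ l) := mul_le_mul hgσ m4 (by positivity) hσ
        _ = _ := by ring
    · calc √t * r * φ l = r * (√t * φ l) := by ring
        _ ≤ 1 * (√l * φ t) := mul_le_mul hr1 m2 (by positivity) zero_le_one
        _ = _ := by ring
  · have hσl : σ * l = 1 := hl1 t ht htl
    have ht0 : 0 < t := hl.1.trans htl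
    have m1 : φ l ≤ φ t := hφ.monotoneOn ⟨hl.1.le, hl.2⟩ ht htl.le
    have m2 : √l * φ t ≤ √t * φ l := hφ.sqrt_mul_le hl.1.le ⟨ht0, ht.2⟩ htl.le
    have m3 : √l ≤ √t := Real.sqrt_le_sqrt htl.le
    have hrt : r * t ≤ l := by
      have h1 : r * (σ * t) * l ≤ 1 * l := mul_le_mul_of_nonneg_right (by linarith) hl.1.le
      have h2 : r * (σ * t) * l = r * t * (σ * l) := by ring
      rw [h2, hσl] at h1
      linarith
    have k1 : √t * g ≤ σ * √l := by
      refine le_of_mul_le_mul_right ?_ hsl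
      calc √t * g * √l ≤ √t * g * √t := by gcongr
        _ = t * g := by rw [mul_right_comm, hss]
        _ ≤ 1 := htg
        _ = σ * √l * √l := by rw [mul_assoc, hssl, hσl]
    have k2 : √t * r ≤ √l := by
      refine le_of_mul_le_mul_right ?_ hsl
      calc √t * r * √l ≤ √t * r * √t := by gcongr
        _ = r * t := by rw [mul_right_comm, hss, mul_comm]
        _ ≤ √l * √l := by rw [hssl]; exact hrt
    refine ⟨?_, ?_, ?_, ?_⟩
    · exact mul_le_mul k1 m1 hP.le (by positivity)
    · refine le_of_mul_le_mul_right ?_ hsl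
      calc √t * r * φ t * √l = √t * r * (√l * φ t) := by ring
        _ ≤ √t * r * (√t * φ l) := by gcongr
        _ = r * (√t * √t) * φ l := by ring
        _ ≤ √l * √l * φ l := by rw [hss, hssl]; gcongr
        _ = _ := by ring
    · refine le_of_mul_le_mul_right ?_ hsl
      calc √t * g * φ t * √l = √t * g * (√l * φ t) := by ring
        _ ≤ √t * g * (√t * φ l) := by gcongr
        _ = (√t * √t) * g * φ l := by ring
        _ ≤ 1 * φ l := by rw [hss]; gcongr
        _ = σ * (√l * √l) * φ l := by rw [hssl, hσl]
        _ = _ := by ring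
    · exact mul_le_mul k2 m1 hP.le hsl.le

end Residual

/-! ### Closed form of the iterates and bounds on the source element. -/

section ErrorRepresentation

open ContinuousLinearMap

variable {𝕜 X Y : Type*} [RCLike 𝕜]
  [NormedAddCommGroup X] [InnerProductSpace 𝕜 X] [CompleteSpace X]
  [NormedAddCommGroup Y] [InnerProductSpace 𝕜 Y] [CompleteSpace Y]

/-- The operator `T* T`. -/
def normalOp (T : X →L[𝕜] Y) : X →L[𝕜] X := T.adjoint ∘L T

variable {T : X →L[𝕜] Y} {f : ℝ → ℝ} {α : ℕ → ℝ} {n : ℕ}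

theorem normalOp_apply (x : X) : normalOp T x = T.adjoint (T x) := rfl

theorem normalOp_isPositive : (normalOp T).IsPositive := isPositive_adjoint_comp_self T

theorem re_inner_normalOp (x : X) : RCLike.re ⟪normalOp T x, x⟫_𝕜 = ‖T x‖ ^ 2 := by
  rw [normalOp_apply, adjoint_inner_left, inner_self_eq_norm_sq]

theorem normalOp_opFun (hf : ContinuousOn f (realSpectrum (normalOp T))) (x : X) :
    normalOp T (opFun (normalOp T) f x) = opFun (normalOp T) (fun t => t * f t) x := by
  rw [opFun_mul (f := fun t => t) normalOp_isPositive.isSelfAdjoint (continuousOn_id' _) hf,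
    opFun_id normalOp_isPositive.isSelfAdjoint, mul_apply_eq_comp]

theorem norm_apply_opFun (hf : ContinuousOn f (realSpectrum (normalOp T))) (x : X) :
    ‖T (opFun (normalOp T) f x)‖ = ‖opFun (normalOp T) (fun t => √t * f t) x‖ := by
  have hS := (normalOp_isPositive (T := T)).isSelfAdjoint
  have h : ContinuousOn (fun t : ℝ => √t) (realSpectrum (normalOp T)) :=
    Real.continuous_sqrt.continuousOn
  rw [← sq_eq_sq₀ (norm_nonneg _) (norm_nonneg _), ← re_inner_normalOp, normalOp_opFun hf,
    norm_opFun_apply_sq hS (h.fun_mul hf), ← inner_comm_of_isSelfAdjoint (isSelfAdjoint_opFun hS hf),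
    ← mul_apply_eq_comp, ← opFun_mul hS hf ((continuousOn_id' _).fun_mul hf)]
  congr 3
  refine opFun_congr hS (hf.fun_mul ((continuousOn_id' _).fun_mul hf)) fun t ht => ?_
  rw [mul_pow, Real.sq_sqrt (realSpectrum_nonneg normalOp_isPositive ht)]
  ring

theorem eq_zero_of_normalOp_add_smul {c : ℝ} (hc : 0 < c) {x : X}
    (h : normalOp T x + (c : 𝕜) • x = 0) : x = 0 := by
  have h1 : RCLike.re ⟪normalOp T x + (c : 𝕜) • x, x⟫_𝕜 = 0 := by rw [h]; simp
  rw [inner_add_left, map_add, re_inner_normalOp, inner_smul_left, RCLike.conj_ofReal,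
    RCLike.re_ofReal_mul, inner_self_eq_norm_sq] at h1
  have h2 : ‖x‖ ^ 2 = 0 := by nlinarith [sq_nonneg ‖T x‖, sq_nonneg ‖x‖]
  simpa using h2

theorem realSpectrum_normalOp_subset : realSpectrum (normalOp T) ⊆ Set.Ici 0 :=
  fun _ ht => realSpectrum_nonneg normalOp_isPositive ht

theorem norm_adjoint_apply_le {A : X →L[𝕜] Y} {K : ℝ} (hK : 0 ≤ K) (h : ∀ x, ‖A x‖ ≤ K * ‖x‖)
    (y : Y) : ‖A.adjoint y‖ ≤ K * ‖y‖ := by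
  refine (A.adjoint.le_opNorm y).trans (mul_le_mul_of_nonneg_right ?_ (norm_nonneg _))
  rw [LinearIsometryEquiv.norm_map]
  exact A.opNorm_le_bound hK h

/-- Each step says `(W + α) V_new = α V_old + T* ζ`. The closed form satisfies the same equation by
the recursions of `residFun` and `filterFun`, and `W + α` is injective. -/
theorem iteration_eq (hα : ∀ k ∈ Finset.Icc 1 n, 0 < α k) {V u : ℕ → X} {ζ : Y}
    (hV : ∀ k ∈ Finset.Icc 1 n, V k = V (k - 1) - u k)
    (hu : ∀ k ∈ Finset.Icc 1 n,
      normalOp T (u k) + (α k : 𝕜) • u k = T.adjoint (T (V (k - 1)) - ζ)) :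
    V n = opFun (normalOp T) (residFun α n) (V 0)
      + opFun (normalOp T) (filterFun α n) (T.adjoint ζ) := by
  have hS := (normalOp_isPositive (T := T)).isSelfAdjoint
  have h1 : opFun (normalOp T) (fun _ => (1 : ℝ)) = 1 := by rw [opFun_const hS]; simp
  induction n with
  | zero =>
    have h0 : opFun (normalOp T) (fun _ => (0 : ℝ)) = 0 := by rw [opFun_const hS]; simp
    have e1 : residFun α 0 = fun _ => (1 : ℝ) := rfl
    have e0 : filterFun α 0 = fun _ => (0 : ℝ) := rfl
    rw [e1, e0, h1, h0]
    simp
  | succ n ih =>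
    obtain ⟨ha, hα'⟩ := pos_of_succ hα
    have hmem : n + 1 ∈ Finset.Icc 1 (n + 1) := by simp
    have hsub : ∀ k ∈ Finset.Icc 1 n, k ∈ Finset.Icc 1 (n + 1) := fun k hk => by
      rw [Finset.mem_Icc] at hk ⊢; omega
    have ih' := ih hα' (fun k hk => hV k (hsub k hk)) (fun k hk => hu k (hsub k hk))
    have cr := (continuousOn_residFun hα').mono (realSpectrum_normalOp_subset (T := T))
    have cg := (continuousOn_filterFun hα').mono (realSpectrum_normalOp_subset (T := T))
    have cr' := (continuousOn_residFun hα).mono (realSpectrum_normalOp_subset (T := T))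
    have cg' := (continuousOn_filterFun hα).mono (realSpectrum_normalOp_subset (T := T))
    have hne : ∀ t ∈ realSpectrum (normalOp T), t + α (n + 1) ≠ 0 := fun t ht => by
      have : 0 ≤ t := realSpectrum_normalOp_subset ht
      positivity
    have er : ∀ x, normalOp T (opFun (normalOp T) (residFun α (n + 1)) x)
        + (α (n + 1) : 𝕜) • opFun (normalOp T) (residFun α (n + 1)) x
        = (α (n + 1) : 𝕜) • opFun (normalOp T) (residFun α n) x := by
      intro x
      rw [normalOp_opFun cr', ← smul_apply, ← smul_apply, ← opFun_const_mul hS cr',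
        ← opFun_const_mul hS cr, ← add_apply,
        ← opFun_add hS ((continuousOn_id' _).fun_mul cr') (cr'.const_mul _)]
      refine congrArg (fun F : X →L[𝕜] X => F x) (opFun_congr hS
        (((continuousOn_id' _).fun_mul cr').fun_add (cr'.const_mul _)) fun t ht => ?_)
      have := hne t ht
      simp only [residFun]
      field_simp
    have eg : ∀ x, normalOp T (opFun (normalOp T) (filterFun α (n + 1)) x)
        + (α (n + 1) : 𝕜) • opFun (normalOp T) (filterFun α (n + 1)) x
        = (α (n + 1) : 𝕜) • opFun (normalOp T) (filterFun α n) x + x := by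
      intro x
      have e1 : x = opFun (normalOp T) (fun _ => (1 : ℝ)) x := by rw [h1]; rfl
      conv_rhs => rw [e1, ← e1]
      nth_rw 4 [e1]
      rw [normalOp_opFun cg', ← smul_apply, ← smul_apply, ← opFun_const_mul hS cg',
        ← opFun_const_mul hS cg, ← add_apply, ← add_apply,
        ← opFun_add hS ((continuousOn_id' _).fun_mul cg') (cg'.const_mul _),
        ← opFun_add hS (cg.const_mul _) continuousOn_const]
      refine congrArg (fun F : X →L[𝕜] X => F x) (opFun_congr hS
        (((continuousOn_id' _).fun_mul cg').fun_add (cg'.const_mul _)) fun t ht => ?_)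
      have := hne t ht
      simp only [filterFun]
      field_simp
    refine sub_eq_zero.mp (eq_zero_of_normalOp_add_smul (T := T) ha ?_)
    have hu' := hu _ hmem
    have hV' := hV _ hmem
    rw [add_tsub_cancel_right] at hu' hV'
    rw [map_sub, ← normalOp_apply] at hu'
    have e2 : normalOp T (V (n + 1)) + (α (n + 1) : 𝕜) • V (n + 1)
        = (α (n + 1) : 𝕜) • V n + T.adjoint ζ := by
      rw [hV', map_sub, smul_sub]
      linear_combination (norm := module) (-1 : 𝕜) • hu'
    have er' := er (V 0)
    have eg' := eg (T.adjoint ζ)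
    rw [ih'] at e2
    rw [map_sub, map_add, smul_sub, smul_add]
    linear_combination (norm := module) e2 - er' - eg'

/-- Expanding the square, the claim becomes `t g² ≤ 2 g`, which follows from `t g ≤ 1`. It bounds
the noise part of the residual by `δ` with constant exactly 1, which is why `C₁ > 1` suffices. -/
theorem norm_filter_sub_le (hα : ∀ k ∈ Finset.Icc 1 n, 0 < α k) (η : Y) :
    ‖T (opFun (normalOp T) (filterFun α n) (T.adjoint η)) - η‖ ≤ ‖η‖ := by
  have hS := (normalOp_isPositive (T := T)).isSelfAdjoint
  have cg := (continuousOn_filterFun hα).mono (realSpectrum_normalOp_subset (T := T))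
  rw [← sq_le_sq₀ (norm_nonneg _) (norm_nonneg _), norm_sub_sq (𝕜 := 𝕜), norm_apply_opFun cg,
    norm_opFun_apply_sq hS (Real.continuous_sqrt.continuousOn.fun_mul cg),
    ← adjoint_inner_right T]
  have h := re_inner_opFun_le hS ((Real.continuous_sqrt.continuousOn.fun_mul cg).fun_pow 2)
    (cg.const_mul 2) (x := T.adjoint η) fun t ht => by
      have h0 : 0 ≤ t := realSpectrum_normalOp_subset ht
      have h1 := filterFun_nonneg hα h0
      have h2 := mul_filterFun_le_one hα h0
      rw [mul_pow, Real.sq_sqrt h0]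
      nlinarith
  rw [opFun_const_mul hS cg, smul_apply, inner_smul_left, RCLike.conj_ofReal,
    RCLike.re_ofReal_mul] at h
  linarith

variable {Q : X →L[𝕜] X} {B κ E C₁ δ : ℝ} {φ : ℝ → ℝ}

/-- Applied with `Q = G^(p-s)` and `V k = G^(-s) (x k - x†)`. The preimage under `Q` is found by
duality, testing `V n` against `x` and bounding by `‖Q x‖`. -/
theorem low_order_bound (hQ : IsSelfAdjoint Q) (hQd : DenseRange Q) (hφ : IsLinkFunction B φ)
    (hB : realSpectrum (normalOp T) ⊆ Set.Icc 0 B) (hκ : 0 < κ)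
    (hFQ : ∀ u, ‖opFun (normalOp T) φ u‖ ≤ ‖Q u‖)
    (hQF : ∀ u, κ * ‖Q u‖ ≤ ‖opFun (normalOp T) φ u‖)
    (hα : ∀ k ∈ Finset.Icc 1 n, 0 < α k) {V u : ℕ → X} {η : Y} {v : X}
    (hV0 : V 0 = - Q v) (hv : ‖v‖ ≤ E) (hη : ‖η‖ ≤ δ) (hC : 1 < C₁)
    (hV : ∀ k ∈ Finset.Icc 1 n, V k = V (k - 1) - u k)
    (hu : ∀ k ∈ Finset.Icc 1 n,
      normalOp T (u k) + (α k : 𝕜) • u k = T.adjoint (T (V (k - 1)) - η))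
    (hdisc : C₁ * δ ≤ ‖T (V n) - η‖) :
    ∃ v' : X, ‖v'‖ ≤ E / κ * (1 + 1 / (C₁ - 1)) ∧ Q v' = V n := by
  have hE : 0 ≤ E := (norm_nonneg v).trans hv
  have hδ : 0 ≤ δ := (norm_nonneg η).trans hη
  have hS := (normalOp_isPositive (T := T)).isSelfAdjoint
  have cr := (continuousOn_residFun hα).mono (realSpectrum_normalOp_subset (T := T))
  have cg := (continuousOn_filterFun hα).mono (realSpectrum_normalOp_subset (T := T))
  have cφ := hφ.continuousOn.mono hB
  obtain ⟨l, hl, hl1, hl2⟩ := exists_cutoff (σ := invSum α n) hφ.pos_right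
  have hsc := fun t ht => filter_residual_bounds hφ hα hl hl2 (hB ht) (t := t)
  have hP := hφ.pos l hl
  have hσ := invSum_nonneg hα
  set W := normalOp T
  set R := opFun W (residFun α n)
  set D := opFun W (filterFun α n)
  -- `K₁` measures the noise amplification in the source element, `K₂ / κ` the residual of the exact
  -- data. The choice of `l` makes their product harmless.
  set K₁ := invSum α n * √l / φ l
  set K₂ := √l * φ l
  have hK₁ : 0 ≤ K₁ := by positivity
  have hK₂ : 0 ≤ K₂ := by positivity
  have hKK : K₁ * K₂ ≤ 1 := by
    have : K₁ * K₂ = invSum α n * (√l * √l) := by simp only [K₁, K₂]; field_simp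
    rw [this, Real.mul_self_sqrt hl.1.le]; exact hl1
  have hVn : V n = R (V 0) + D (T.adjoint η) := iteration_eq hα hV hu
  have hRsa : IsSelfAdjoint R := isSelfAdjoint_opFun hS cr
  have hDsa : IsSelfAdjoint D := isSelfAdjoint_opFun hS cg
  have hQR : ∀ x, κ * ‖Q (R x)‖ ≤ ‖opFun W (fun t => residFun α n t * φ t) x‖ := by
    intro x
    refine (hQF _).trans_eq ?_
    rw [opFun_apply_comm hS cφ cr, ← mul_apply_eq_comp, ← opFun_mul hS cr cφ]
  -- the data misfit controls the noise level
  have hTRQ : ‖T (R (Q v))‖ ≤ K₂ / κ * ‖v‖ := by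
    -- Taking adjoints moves `Q` to the outer position, where it can be replaced by `φ(W)` through
    -- `hQF`.
    have e : T (R (Q v)) = ((Q ∘L R ∘L T.adjoint).adjoint) v := by
      simp [adjoint_comp, hRsa.adjoint_eq, hQ.adjoint_eq]
    rw [e]
    refine norm_adjoint_apply_le (by positivity) (fun y => ?_) v
    have h1 : ‖opFun W (fun t => residFun α n t * φ t) (T.adjoint y)‖ ≤ K₂ * ‖y‖ := by
      have e2 : opFun W (fun t => residFun α n t * φ t) (T.adjoint y)
          = (T ∘L opFun W (fun t => residFun α n t * φ t)).adjoint y := by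
        simp [adjoint_comp, (isSelfAdjoint_opFun hS (cr.fun_mul cφ)).adjoint_eq]
      rw [e2]
      refine norm_adjoint_apply_le hK₂ (fun x => ?_) y
      rw [comp_apply, norm_apply_opFun (cr.fun_mul cφ)]
      refine (le_opNorm _ _).trans (mul_le_mul_of_nonneg_right ?_ (norm_nonneg _))
      refine norm_opFun_le hS (Real.continuous_sqrt.continuousOn.fun_mul (cr.fun_mul cφ)) hK₂
        fun t ht => ?_
      rw [abs_of_nonneg (mul_nonneg (Real.sqrt_nonneg t) (mul_nonneg
        (residFun_nonneg hα (hB ht).1) (hφ.nonneg t (hB ht))))]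
      exact (hsc t ht).2.1
    have h2 := hQR (T.adjoint y)
    rw [div_mul_eq_mul_div, le_div_iff₀ hκ, mul_comm]
    exact h2.trans h1
  -- The residual is at least `C₁ δ`, and its noise part is at most `δ`; the rest must come from the
  -- exact data.
  have hdK : δ * (C₁ - 1) ≤ K₂ / κ * E := by
    have e : T (V n) - η = -T (R (Q v)) + (T (D (T.adjoint η)) - η) := by
      rw [hVn, hV0, map_add, map_neg, map_neg]; abel
    have h1 := norm_add_le (-T (R (Q v))) (T (D (T.adjoint η)) - η)
    rw [← e, norm_neg] at h1
    have h2 := norm_filter_sub_le (T := T) hα η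
    have h3 : K₂ / κ * ‖v‖ ≤ K₂ / κ * E := by gcongr
    linarith
  have hC' : 0 < C₁ - 1 := by linarith
  have hKδ : K₁ * δ ≤ E / κ * (1 / (C₁ - 1)) := by
    have h1 : K₁ * (δ * (C₁ - 1)) ≤ E / κ := by
      calc K₁ * (δ * (C₁ - 1)) ≤ K₁ * (K₂ / κ * E) := by gcongr
        _ = (K₁ * K₂) * (E / κ) := by ring
        _ ≤ 1 * (E / κ) := by gcongr
        _ = _ := one_mul _
    rw [mul_one_div, le_div_iff₀ hC']
    linarith
  refine exists_preimage_of_inner_le hQ hQd (by positivity) fun x => ?_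
  have i1 : ⟪V n, x⟫_𝕜 = -⟪v, Q (R x)⟫_𝕜 + ⟪η, T (D x)⟫_𝕜 := by
    rw [hVn, hV0, inner_add_left, inner_comm_of_isSelfAdjoint hRsa, inner_neg_left,
      inner_comm_of_isSelfAdjoint hQ, inner_comm_of_isSelfAdjoint hDsa, adjoint_inner_left]
  have i2 : ‖Q (R x)‖ ≤ 1 / κ * ‖Q x‖ := by
    rw [one_div, inv_mul_eq_div, le_div_iff₀ hκ, mul_comm]
    refine (hQR x).trans (le_trans ?_ (hFQ x))
    refine norm_opFun_apply_le hS (cr.fun_mul cφ) cφ (fun t ht => ?_) x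
    rw [abs_mul, abs_of_nonneg (residFun_nonneg hα (hB ht).1)]
    exact mul_le_of_le_one_left (abs_nonneg _) (residFun_le_one hα (hB ht).1)
  have i3 : ‖T (D x)‖ ≤ K₁ * ‖Q x‖ := by
    rw [norm_apply_opFun cg]
    refine (norm_opFun_apply_le_mul hS (Real.continuous_sqrt.continuousOn.fun_mul cg) cφ hK₁
      (fun t ht => ?_) x).trans (mul_le_mul_of_nonneg_left (hFQ x) hK₁)
    rw [abs_of_nonneg (hφ.nonneg t (hB ht)), abs_of_nonneg (mul_nonneg (Real.sqrt_nonneg t)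
      (filterFun_nonneg hα (hB ht).1))]
    exact (hsc t ht).1
  rw [i1]
  refine (norm_add_le _ _).trans ?_
  rw [norm_neg]
  calc ‖⟪v, Q (R x)⟫_𝕜‖ + ‖⟪η, T (D x)⟫_𝕜‖
      ≤ ‖v‖ * ‖Q (R x)‖ + ‖η‖ * ‖T (D x)‖ :=
        add_le_add (norm_inner_le_norm _ _) (norm_inner_le_norm _ _)
    _ ≤ E * (1 / κ * ‖Q x‖) + δ * (K₁ * ‖Q x‖) := by gcongr
    _ = (E / κ + K₁ * δ) * ‖Q x‖ := by ring
    _ ≤ (E / κ + E / κ * (1 / (C₁ - 1))) * ‖Q x‖ := by gcongr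
    _ = _ := by ring

/-- Applied with `Q = G^(s-p)` and `L = A G^p`. The exact solution need not lie in the range of
`G^s`, so the iterate itself is bounded rather than the error, and estimates in `v` are proved on
the dense range of `Q`, where `L Q = T`. -/
theorem high_order_bound (hQd : DenseRange Q) (hφ : IsLinkFunction B φ)
    (hB : realSpectrum (normalOp T) ⊆ Set.Icc 0 B) (hκ : 0 < κ)
    (hFQ : ∀ u, ‖opFun (normalOp T) φ u‖ ≤ ‖Q u‖)
    (hQF : ∀ u, κ * ‖Q u‖ ≤ ‖opFun (normalOp T) φ u‖) {L : X →L[𝕜] Y} (hL : ∀ u, T u = L (Q u))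
    (hα : ∀ k ∈ Finset.Icc 1 n, 0 < α k) {V u : ℕ → X} {η : Y} {v : X}
    (hV0 : V 0 = 0) (hv : ‖v‖ ≤ E) (hη : ‖η‖ ≤ δ) (hC : 1 < C₁)
    (hV : ∀ k ∈ Finset.Icc 1 n, V k = V (k - 1) - u k)
    (hu : ∀ k ∈ Finset.Icc 1 n,
      normalOp T (u k) + (α k : 𝕜) • u k = T.adjoint (T (V (k - 1)) - (L v + η)))
    (hdisc : C₁ * δ ≤ ‖T (V n) - (L v + η)‖) :
    ‖Q (V n)‖ ≤ E / κ * (1 + 1 / (C₁ - 1)) := by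
  have hE : 0 ≤ E := (norm_nonneg v).trans hv
  have hS := (normalOp_isPositive (T := T)).isSelfAdjoint
  have cr := (continuousOn_residFun hα).mono (realSpectrum_normalOp_subset (T := T))
  have cg := (continuousOn_filterFun hα).mono (realSpectrum_normalOp_subset (T := T))
  have cφ := hφ.continuousOn.mono hB
  obtain ⟨l, hl, hl1, hl2⟩ := exists_cutoff (σ := invSum α n) hφ.pos_right
  have hsc := fun t ht => filter_residual_bounds hφ hα hl hl2 (hB ht) (t := t)
  have hP := hφ.pos l hl
  have hσ := invSum_nonneg hα
  have hTL : ∀ x, T.adjoint (L (Q x)) = normalOp T x := fun x => by rw [← hL, normalOp_apply]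
  set W := normalOp T
  set R := opFun W (residFun α n)
  set D := opFun W (filterFun α n)
  set F := opFun W φ
  set K₁ := invSum α n * √l * φ l
  set K₂ := √l / φ l
  have hK₁ : 0 ≤ K₁ := by positivity
  have hK₂ : 0 ≤ K₂ := by positivity
  have hKK : K₁ * K₂ ≤ 1 := by
    have : K₁ * K₂ = invSum α n * (√l * √l) := by simp only [K₁, K₂]; field_simp
    rw [this, Real.mul_self_sqrt hl.1.le]; exact hl1
  have hVn : V n = D (T.adjoint (L v + η)) := by
    rw [iteration_eq hα hV hu, hV0, map_zero, zero_add]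
  have hDW : ∀ x, D (W x) = opFun W (fun t => t * filterFun α n t) x := fun x => by
    conv_lhs => rw [← opFun_id hS]
    rw [opFun_id hS, ← normalOp_opFun cg]
    have := opFun_apply_comm hS cg (g := fun t => t) (continuousOn_id' _) x
    rwa [opFun_id hS] at this
  have b1 : ∀ v : X, ‖F (D (T.adjoint (L v)))‖ ≤ ‖v‖ := by
    intro v
    refine hQd.induction_on v (isClosed_le (by fun_prop) (by fun_prop)) fun x => ?_
    rw [hTL, hDW]
    have e : F (opFun W (fun t => t * filterFun α n t) x)
        = opFun W (fun t => φ t * (t * filterFun α n t)) x := by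
      rw [opFun_mul hS cφ ((continuousOn_id' _).fun_mul cg)]; rfl
    rw [e]
    refine le_trans (norm_opFun_apply_le hS (cφ.fun_mul ((continuousOn_id' _).fun_mul cg)) cφ
      (fun t ht => ?_) x) (hFQ x)
    have h0 := (hB ht).1
    rw [abs_mul, abs_of_nonneg (mul_nonneg h0 (filterFun_nonneg hα h0))]
    exact mul_le_of_le_one_right (abs_nonneg _) (mul_filterFun_le_one hα h0)
  have b2 : ‖F (D (T.adjoint η))‖ ≤ K₁ * ‖η‖ := by
    have e : F (D (T.adjoint η))
        = (T ∘L opFun W (fun t => filterFun α n t * φ t)).adjoint η := by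
      rw [opFun_apply_comm hS cφ cg, ← mul_apply_eq_comp, ← opFun_mul hS cg cφ]
      simp [adjoint_comp, (isSelfAdjoint_opFun hS (cg.fun_mul cφ)).adjoint_eq]
    rw [e]
    refine norm_adjoint_apply_le hK₁ (fun x => ?_) η
    rw [comp_apply, norm_apply_opFun (cg.fun_mul cφ)]
    refine (le_opNorm _ _).trans (mul_le_mul_of_nonneg_right ?_ (norm_nonneg _))
    refine norm_opFun_le hS (Real.continuous_sqrt.continuousOn.fun_mul (cg.fun_mul cφ)) hK₁
      fun t ht => ?_
    rw [abs_of_nonneg (mul_nonneg (Real.sqrt_nonneg t) (mul_nonneg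
      (filterFun_nonneg hα (hB ht).1) (hφ.nonneg t (hB ht))))]
    exact (hsc t ht).2.2.1
  have b3 : ∀ v : X, ‖T (D (T.adjoint (L v))) - L v‖ ≤ K₂ * ‖v‖ := by
    intro v
    refine hQd.induction_on v (isClosed_le (by fun_prop) (by fun_prop)) fun x => ?_
    have e : T (D (T.adjoint (L (Q x)))) - L (Q x) = -T (R x) := by
      have e1 : D (W x) = x - R x := by
        have h1 : opFun W (fun _ => (1 : ℝ)) = 1 := by rw [opFun_const hS]; simp
        have h2 : x - R x = (1 - R) x := rfl
        rw [hDW, h2, ← h1, ← opFun_sub hS continuousOn_const cr]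
        exact congrArg (fun F : X →L[𝕜] X => F x) (opFun_congr hS ((continuousOn_id' _).fun_mul cg)
          fun t ht => mul_filterFun hα (hB ht).1)
      rw [hTL, e1, map_sub, hL x]
      abel
    rw [e, norm_neg, norm_apply_opFun cr]
    refine (norm_opFun_apply_le_mul hS (Real.continuous_sqrt.continuousOn.fun_mul cr) cφ hK₂
      (fun t ht => ?_) x).trans (mul_le_mul_of_nonneg_left (hFQ x) hK₂)
    rw [abs_of_nonneg (hφ.nonneg t (hB ht)), abs_of_nonneg (mul_nonneg (Real.sqrt_nonneg t)
      (residFun_nonneg hα (hB ht).1))]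
    exact (hsc t ht).2.2.2
  -- As in the low order case: the discrepancy inequality exceeds the filtered noise by `(C₁ - 1)
  -- δ`.
  have hdK : δ * (C₁ - 1) ≤ K₂ * E := by
    have e : T (V n) - (L v + η)
        = (T (D (T.adjoint (L v))) - L v) + (T (D (T.adjoint η)) - η) := by
      rw [hVn, map_add, map_add, map_add]; abel
    have h1 := norm_add_le (T (D (T.adjoint (L v))) - L v) (T (D (T.adjoint η)) - η)
    rw [← e] at h1
    have h2 := norm_filter_sub_le (T := T) hα η
    have h3 : K₂ * ‖v‖ ≤ K₂ * E := by gcongr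
    linarith [b3 v]
  have hC' : 0 < C₁ - 1 := by linarith
  have hKδ : K₁ * δ ≤ E * (1 / (C₁ - 1)) := by
    have h1 : K₁ * (δ * (C₁ - 1)) ≤ E := by
      calc K₁ * (δ * (C₁ - 1)) ≤ K₁ * (K₂ * E) := by gcongr
        _ = (K₁ * K₂) * E := by ring
        _ ≤ 1 * E := by gcongr
        _ = _ := one_mul _
    rw [mul_one_div, le_div_iff₀ hC']
    linarith
  rw [div_mul_eq_mul_div, le_div_iff₀ hκ, mul_comm]
  refine (hQF _).trans ?_
  rw [hVn, map_add, map_add, map_add]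
  calc ‖F (D (T.adjoint (L v))) + F (D (T.adjoint η))‖ ≤ ‖v‖ + K₁ * ‖η‖ :=
        (norm_add_le _ _).trans (add_le_add (b1 v) b2)
    _ ≤ E + K₁ * δ := by gcongr
    _ ≤ E * (1 + 1 / (C₁ - 1)) := by linarith

end ErrorRepresentation

/-! ### Index functions, their inverses and the induced link functions. -/

section IndexFunctions

variable {a : ℝ} {ψ ϱ : ℝ → ℝ}

theorem IsIndexFunction.nonneg (hψ : IsIndexFunction a ψ) {t : ℝ} (ht : t ∈ Set.Icc 0 a) :
    0 ≤ ψ t := by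
  rw [← hψ.1]
  exact hψ.2.2.monotoneOn ⟨le_rfl, ht.1.trans ht.2⟩ ht ht.1

theorem IsIndexFunction.pos (hψ : IsIndexFunction a ψ) {t : ℝ} (ht : t ∈ Set.Ioc 0 a) :
    0 < ψ t := by
  rw [← hψ.1]
  exact hψ.2.2 ⟨le_rfl, ht.1.le.trans ht.2⟩ ⟨ht.1.le, ht.2⟩ ht.1

theorem indexInv_apply (hψ : IsIndexFunction a ψ) {t : ℝ} (ht : t ∈ Set.Icc 0 a) :
    indexInv a ψ (ψ t) = t := by
  refine (IsGreatest.csSup_eq ⟨⟨ht, le_rfl⟩, ?_⟩)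
  rintro u ⟨hu, huv⟩
  exact (hψ.2.2.le_iff_le hu ht).mp huv

theorem indexInv_of_ge (ha : 0 ≤ a) {τ : ℝ} (hτ : ψ a ≤ τ) :
    indexInv a ψ τ = a :=
  IsGreatest.csSup_eq ⟨⟨⟨ha, le_rfl⟩, hτ⟩, fun _ hu => hu.1.2⟩

theorem IsIndexFunction.exists_eq (hψ : IsIndexFunction a ψ) (ha : 0 ≤ a) {τ : ℝ} (h0 : 0 ≤ τ)
    (hτ : τ ≤ ψ a) : ∃ t ∈ Set.Icc 0 a, ψ t = τ :=
  intermediate_value_Icc ha hψ.2.1 ⟨by rwa [hψ.1], hτ⟩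

theorem indexInv_mem (hψ : IsIndexFunction a ψ) (ha : 0 ≤ a) {τ : ℝ} (h0 : 0 ≤ τ) :
    indexInv a ψ τ ∈ Set.Icc 0 a := by
  rcases le_total τ (ψ a) with h | h
  · obtain ⟨t, ht, rfl⟩ := hψ.exists_eq ha h0 h
    rwa [indexInv_apply hψ ht]
  · rw [indexInv_of_ge ha h]
    exact ⟨ha, le_rfl⟩

theorem apply_indexInv_le (hψ : IsIndexFunction a ψ) (ha : 0 ≤ a) {τ : ℝ} (h0 : 0 ≤ τ) :
    ψ (indexInv a ψ τ) ≤ τ := by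
  rcases le_total τ (ψ a) with h | h
  · obtain ⟨t, ht, rfl⟩ := hψ.exists_eq ha h0 h
    rw [indexInv_apply hψ ht]
  · rwa [indexInv_of_ge ha h]

theorem monotoneOn_indexInv (hψ : IsIndexFunction a ψ) (ha : 0 ≤ a) :
    MonotoneOn (indexInv a ψ) (Set.Ici 0) := by
  intro τ hτ τ' _ h
  exact csSup_le_csSup ⟨a, fun _ hu => hu.1.2⟩ ⟨0, ⟨le_rfl, ha⟩, by rw [hψ.1]; exact hτ⟩
    fun u hu => ⟨hu.1, hu.2.trans h⟩

/-- A monotone surjection between intervals is continuous. -/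
theorem continuousOn_indexInv (hψ : IsIndexFunction a ψ) (ha : 0 ≤ a) :
    ContinuousOn (indexInv a ψ) (Set.Icc 0 (ψ a)) := by
  rw [continuousOn_iff_continuous_domRestrict]
  let g : Set.Icc 0 (ψ a) → Set.Icc 0 a := fun τ => ⟨indexInv a ψ τ, indexInv_mem hψ ha τ.2.1⟩
  have hg : Monotone g := fun τ τ' h => monotoneOn_indexInv hψ ha τ.2.1 τ'.2.1 h
  have hs : Function.Surjective g := fun t =>
    ⟨⟨ψ t, hψ.nonneg t.2, hψ.2.2.monotoneOn t.2 ⟨ha, le_rfl⟩ t.2.2⟩,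
      Subtype.ext (indexInv_apply hψ t.2)⟩
  exact continuous_subtype_val.comp (hg.continuous_of_surjective hs)

theorem isIndexFunction_psi (hϱ : IsIndexFunction a ϱ) {r : ℝ} (hr : 0 ≤ r) :
    IsIndexFunction a (psi ϱ r) := by
  refine ⟨by simp [psi, hϱ.1], (continuous_rpow_of_nonneg hr).continuousOn.mul hϱ.2.1, ?_⟩
  intro t ht t' ht' h
  have h1 : t ^ r ≤ t' ^ r := Real.rpow_le_rpow ht.1 h.le hr
  have h2 : 0 < t' := ht.1.trans_lt h
  exact mul_lt_mul_of_le_of_lt_of_nonneg_of_pos h1 (hϱ.2.2 ht ht' h) (hϱ.nonneg ht)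
    (Real.rpow_pos_of_pos h2 r)

/-- The function `t ↦ ψ⁻¹(√t) ^ q`. -/
def invSqrtPow (a : ℝ) (ψ : ℝ → ℝ) (q t : ℝ) : ℝ := indexInv a ψ (√t) ^ q

theorem invSqrtPow_sq (hψ : IsIndexFunction a ψ) (q : ℝ) {t : ℝ} (ht : t ∈ Set.Icc 0 a) :
    invSqrtPow a ψ q (ψ t ^ 2) = t ^ q := by
  rw [invSqrtPow, Real.sqrt_sq (hψ.nonneg ht), indexInv_apply hψ ht]

theorem sqrt_mem_Icc {b t : ℝ} (hb : 0 ≤ b) (ht : t ∈ Set.Icc 0 (b ^ 2)) : √t ∈ Set.Icc 0 b :=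
  ⟨Real.sqrt_nonneg t, Real.sqrt_le_iff.mpr ⟨hb, ht.2⟩⟩

theorem exists_sq_eq (hψ : IsIndexFunction a ψ) (ha : 0 ≤ a) {t : ℝ}
    (ht : t ∈ Set.Ioc 0 (ψ a ^ 2)) : ∃ u ∈ Set.Ioc 0 a, t = ψ u ^ 2 := by
  have hs := sqrt_mem_Icc (hψ.nonneg ⟨ha, le_rfl⟩) ⟨ht.1.le, ht.2⟩
  obtain ⟨u, hu, hut⟩ := hψ.exists_eq ha hs.1 hs.2
  refine ⟨u, ⟨lt_of_le_of_ne hu.1 ?_, hu.2⟩, ?_⟩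
  · rintro rfl
    rw [hψ.1] at hut
    exact (Real.sqrt_pos.mpr ht.1).ne hut
  · rw [hut, Real.sq_sqrt ht.1.le]

theorem isLinkFunction_invSqrtPow (hψ : IsIndexFunction a ψ) (ha : 0 < a) {q : ℝ} (hq : 0 ≤ q)
    (hanti : AntitoneOn (fun t => invSqrtPow a ψ q t / √t) (Set.Ioc 0 (ψ a ^ 2))) :
    IsLinkFunction (ψ a ^ 2) (invSqrtPow a ψ q) where
  pos_right := pow_pos (hψ.pos ⟨ha, le_rfl⟩) 2
  continuousOn := (continuous_rpow_of_nonneg hq).comp_continuousOn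
    ((continuousOn_indexInv hψ ha.le).comp Real.continuous_sqrt.continuousOn
      fun _ ht => sqrt_mem_Icc (hψ.nonneg ⟨ha.le, le_rfl⟩) ht)
  nonneg t _ := Real.rpow_nonneg (indexInv_mem hψ ha.le (Real.sqrt_nonneg t)).1 q
  pos t ht := by
    obtain ⟨u, hu, rfl⟩ := exists_sq_eq hψ ha.le ht
    rw [invSqrtPow_sq hψ q ⟨hu.1.le, hu.2⟩]
    exact Real.rpow_pos_of_pos hu.1 q
  monotoneOn t _ t' _ h := Real.rpow_le_rpow (indexInv_mem hψ ha.le (Real.sqrt_nonneg t)).1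
    (monotoneOn_indexInv hψ ha.le (Real.sqrt_nonneg t) (Real.sqrt_nonneg t')
      (Real.sqrt_le_sqrt h)) hq
  antitoneOn := hanti

/-- Used with `c = M²`, because the spectrum of `T* T` reaches up to `M² ψ(‖G‖)²` only. -/
theorem IsLinkFunction.comp_div {B : ℝ} {φ : ℝ → ℝ} (h : IsLinkFunction B φ) {c : ℝ}
    (hc : 0 < c) : IsLinkFunction (c * B) (fun t => φ (t / c)) := by
  have hI : ∀ t ∈ Set.Icc 0 (c * B), t / c ∈ Set.Icc 0 B := fun t ht =>
    ⟨div_nonneg ht.1 hc.le, by rw [div_le_iff₀ hc, mul_comm]; exact ht.2⟩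
  have hI' : ∀ t ∈ Set.Ioc 0 (c * B), t / c ∈ Set.Ioc 0 B := fun t ht =>
    ⟨div_pos ht.1 hc, (hI t ⟨ht.1.le, ht.2⟩).2⟩
  refine ⟨mul_pos hc h.pos_right, h.continuousOn.comp (by fun_prop) hI,
    fun t ht => h.nonneg _ (hI t ht), fun t ht => h.pos _ (hI' t ht),
    fun t ht t' ht' htt => h.monotoneOn (hI t ht) (hI t' ht') (by gcongr), ?_⟩
  intro t ht t' ht' htt
  have h1 := h.antitoneOn (hI' t ht) (hI' t' ht') (by gcongr)
  have h2 : ∀ u, φ (u / c) / √u = φ (u / c) / √(u / c) / √c := by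
    intro u
    rw [Real.sqrt_div' _ hc.le, div_div, div_mul_cancel₀ _ (Real.sqrt_pos.mpr hc).ne']
  simp only [] at h1 ⊢
  rw [h2, h2]
  gcongr

/-- In the high order case `p ≤ s` the monotonicity of `ψ⁻¹(√t) ^ (s - p) / √t` is automatic. -/
theorem antitoneOn_of_high_order (hϱ : IsIndexFunction a ϱ) (ha : 0 < a) {p s : ℝ} (hp : 0 < p)
    (hψ : IsIndexFunction a (psi ϱ s)) :
    AntitoneOn (fun t => invSqrtPow a (psi ϱ s) (s - p) t / √t) (Set.Ioc 0 (psi ϱ s a ^ 2)) := by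
  have hψp := isIndexFunction_psi hϱ hp.le
  -- In the variable `u = ψ_s⁻¹(√t)` the quotient is `u^(s-p) / (u^s ϱ(u)) = 1 / ψ_p(u)`.
  have key : ∀ u ∈ Set.Ioc 0 a, invSqrtPow a (psi ϱ s) (s - p) (psi ϱ s u ^ 2)
      / √(psi ϱ s u ^ 2) = 1 / psi ϱ p u := by
    intro u hu
    have hu' : u ∈ Set.Icc 0 a := ⟨hu.1.le, hu.2⟩
    rw [invSqrtPow_sq hψ _ hu', Real.sqrt_sq (hψ.nonneg hu'), psi, psi, Real.rpow_sub hu.1]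
    have := hϱ.pos hu
    have h1 := Real.rpow_pos_of_pos hu.1 s
    have h2 := Real.rpow_pos_of_pos hu.1 p
    field_simp
  intro t ht t' ht' h
  obtain ⟨u, hu, rfl⟩ := exists_sq_eq hψ ha.le ht
  obtain ⟨u', hu', rfl⟩ := exists_sq_eq hψ ha.le ht'
  have hI : u ∈ Set.Icc 0 a := ⟨hu.1.le, hu.2⟩
  have hI' : u' ∈ Set.Icc 0 a := ⟨hu'.1.le, hu'.2⟩
  have huu : u ≤ u' := (hψ.2.2.le_iff_le hI hI').mp
    ((sq_le_sq₀ (hψ.nonneg hI) (hψ.nonneg hI')).mp h)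
  simp only []
  rw [key u hu, key u' hu']
  exact one_div_le_one_div_of_le (hψp.pos hu) (hψp.2.2.monotoneOn hI hI' huu)

/-- Change of the argument of `ψ_p⁻¹` by a constant factor. -/
theorem indexInv_rpow_le (hϱ : IsIndexFunction a ϱ) {p : ℝ} (hp : 0 < p) {t c : ℝ}
    (ht : t ∈ Set.Ioc 0 a) (hc : 0 ≤ c) :
    indexInv a (psi ϱ p) (c * psi ϱ p t) ^ p ≤ (1 + c) * t ^ p := by
  have hψ := isIndexFunction_psi hϱ hp.le
  have ha : 0 < a := ht.1.trans_le ht.2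
  have hτ : 0 ≤ c * psi ϱ p t := mul_nonneg hc (hψ.pos ht).le
  have hmem := indexInv_mem hψ ha.le hτ
  have hle := apply_indexInv_le hψ ha.le hτ
  set u := indexInv a (psi ϱ p) (c * psi ϱ p t)
  have htp : 0 < t ^ p := Real.rpow_pos_of_pos ht.1 p
  -- For `u ≥ t` one has `u^p ϱ(u) ≤ c t^p ϱ(t) ≤ c t^p ϱ(u)`, and `ϱ(u)` cancels; `1 + c` covers
  -- both cases.
  rcases le_total u t with h | h
  · have := Real.rpow_le_rpow hmem.1 h hp.le
    nlinarith
  · have hu : 0 < u := ht.1.trans_le h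
    have hϱu := hϱ.pos ⟨hu, hmem.2⟩
    have hmono := hϱ.2.2.monotoneOn ⟨ht.1.le, ht.2⟩ hmem h
    have : u ^ p * ϱ u ≤ c * t ^ p * ϱ u := by
      calc u ^ p * ϱ u ≤ c * (t ^ p * ϱ t) := hle
        _ ≤ c * (t ^ p * ϱ u) := by gcongr
        _ = _ := by ring
    have := le_of_mul_le_mul_right this hϱu
    linarith

end IndexFunctions

/-! ### From the link condition to powers of `G`. -/

section LinkConditions

open ContinuousLinearMap

variable {𝕜 X Y : Type*} [RCLike 𝕜]
  [NormedAddCommGroup X] [InnerProductSpace 𝕜 X] [CompleteSpace X]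
  [NormedAddCommGroup Y] [InnerProductSpace 𝕜 Y]

theorem isPositive_opFun {S : X →L[𝕜] X} (hS : IsSelfAdjoint S) {f : ℝ → ℝ}
    (hf : ContinuousOn f (realSpectrum S)) (h : ∀ t ∈ realSpectrum S, 0 ≤ f t) :
    (opFun S f).IsPositive :=
  isPositive_def'.mpr ⟨isSelfAdjoint_opFun hS hf, re_inner_opFun_nonneg hS hf h⟩

theorem le_of_re_inner_le {S S' : X →L[𝕜] X} (hS : IsSelfAdjoint S) (hS' : IsSelfAdjoint S')
    (h : ∀ x, RCLike.re ⟪S x, x⟫_𝕜 ≤ RCLike.re ⟪S' x, x⟫_𝕜) : S ≤ S' := by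
  rw [ContinuousLinearMap.le_def]
  refine isPositive_def'.mpr ⟨hS'.sub hS, fun x => ?_⟩
  rw [reApplyInnerSelf_apply, sub_apply, inner_sub_left, map_sub]
  exact sub_nonneg.mpr (h x)

variable {G : X →L[𝕜] X} {T : X →L[𝕜] Y} {ψ : ℝ → ℝ} {m M q : ℝ}

theorem norm_opFun_le_right (hG : G.IsPositive) (hψ : IsIndexFunction ‖G‖ ψ) :
    ‖opFun G ψ‖ ≤ ψ ‖G‖ := by
  have hc := realSpectrum_subset_Icc hG
  have hG0 : ‖G‖ ∈ Set.Icc 0 ‖G‖ := ⟨norm_nonneg _, le_rfl⟩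
  refine norm_opFun_le hG.isSelfAdjoint (hψ.2.1.mono hc) (hψ.nonneg hG0) fun t ht => ?_
  rw [abs_of_nonneg (hψ.nonneg (hc ht))]
  exact hψ.2.2.monotoneOn (hc ht) hG0 (hc ht).2

theorem norm_le_of_link (hG : G.IsPositive) (hψ : IsIndexFunction ‖G‖ ψ) (hM : 0 < M)
    (h : ∀ u, ‖T u‖ ≤ M * ‖opFun G ψ u‖) : ‖T‖ ≤ M * ψ ‖G‖ := by
  have h0 := (norm_nonneg _).trans (norm_opFun_le_right hG hψ)
  refine T.opNorm_le_bound (by positivity) fun u => (h u).trans ?_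
  rw [mul_assoc]
  exact mul_le_mul_of_nonneg_left (le_of_opNorm_le _ (norm_opFun_le_right hG hψ) u) hM.le

variable [CompleteSpace Y]

theorem norm_normalOp_le (hG : G.IsPositive) (hψ : IsIndexFunction ‖G‖ ψ) (hM : 0 < M)
    (h : ∀ u, ‖T u‖ ≤ M * ‖opFun G ψ u‖) : ‖normalOp T‖ ≤ M ^ 2 * ψ ‖G‖ ^ 2 := by
  have hT := norm_le_of_link hG hψ hM h
  refine (opNorm_comp_le _ _).trans ?_
  rw [LinearIsometryEquiv.norm_map, ← mul_pow, pow_two]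
  exact mul_le_mul hT hT (norm_nonneg _) ((norm_nonneg _).trans hT)

theorem realSpectrum_normalOp_subset_Icc (hG : G.IsPositive) (hψ : IsIndexFunction ‖G‖ ψ)
    (hM : 0 < M) (h : ∀ u, ‖T u‖ ≤ M * ‖opFun G ψ u‖) :
    realSpectrum (normalOp T) ⊆ Set.Icc 0 (M ^ 2 * ψ ‖G‖ ^ 2) :=
  (realSpectrum_subset_Icc normalOp_isPositive).trans
    (Set.Icc_subset_Icc_right (norm_normalOp_le hG hψ hM h))

/-- Operator monotonicity turns the link condition for `T` into a link condition between powers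
of `G` and a function of `T* T`. -/
theorem link_of_operatorMonotone (hG : G.IsPositive) (hψ : IsIndexFunction ‖G‖ ψ)
    (hm : 0 < m) (hmM : m ≤ M) (hlow : ∀ u, m * ‖opFun G ψ u‖ ≤ ‖T u‖)
    (hup : ∀ u, ‖T u‖ ≤ M * ‖opFun G ψ u‖) (hq : 0 ≤ q)
    (hf : IsLinkFunction (ψ ‖G‖ ^ 2) (invSqrtPow ‖G‖ ψ q))
    (hmon : OperatorMonotone 𝕜 X (ψ ‖G‖ ^ 2) (fun t => invSqrtPow ‖G‖ ψ q t ^ 2)) (x : X) :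
    ‖opFun (normalOp T) (fun t => invSqrtPow ‖G‖ ψ q (t / M ^ 2)) x‖ ≤ ‖opPow G q x‖ ∧
    m / M * ‖opPow G q x‖ ≤
      ‖opFun (normalOp T) (fun t => invSqrtPow ‖G‖ ψ q (t / M ^ 2)) x‖ := by
  have hM : 0 < M := hm.trans_le hmM
  have hM2 : 0 < M ^ 2 := by positivity
  set κ := m / M
  have hκ : 0 < κ := div_pos hm hM
  have hκ1 : κ ^ 2 ≤ 1 := pow_le_one₀ hκ.le ((div_le_one hM).mpr hmM)
  have hGs := hG.isSelfAdjoint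
  have hGI := realSpectrum_subset_Icc hG
  have hGm : ‖G‖ ∈ Set.Icc 0 ‖G‖ := ⟨norm_nonneg _, le_rfl⟩
  have hW := normalOp_isPositive (T := T)
  have hWs := hW.isSelfAdjoint
  have hWI := realSpectrum_normalOp_subset_Icc hG hψ hM hup
  set f := invSqrtPow ‖G‖ ψ q
  set b := ψ ‖G‖ ^ 2
  have hb : 0 < b := hf.pos_right
  have hfc := hf.continuousOn
  have hf2 : ContinuousOn (fun t => f t ^ 2) (Set.Icc 0 b) := hfc.fun_pow 2
  have hψc : ContinuousOn ψ (realSpectrum G) := hψ.2.1.mono hGI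
  have hψ2 : ∀ t ∈ Set.Icc 0 ‖G‖, ψ t ^ 2 ∈ Set.Icc 0 b := fun t ht =>
    ⟨sq_nonneg _, pow_le_pow_left₀ (hψ.nonneg ht) (hψ.2.2.monotoneOn ht hGm ht.2) 2⟩
  have hκψ2 : ∀ t ∈ Set.Icc 0 ‖G‖, κ ^ 2 * ψ t ^ 2 ∈ Set.Icc 0 b := fun t ht =>
    ⟨by positivity, (mul_le_of_le_one_left (sq_nonneg _) hκ1).trans (hψ2 t ht).2⟩
  -- the three operators to be compared
  have hdiv : Continuous fun t : ℝ => t / M ^ 2 := by fun_prop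
  -- Division by `M²` gives `S₁ ≤ S ≤ S₂` with all three spectra in `[0, b]`, the range on which
  -- monotonicity is assumed.
  set S := opFun (normalOp T) (fun t => t / M ^ 2)
  set S₁ := opFun G (fun t => κ ^ 2 * ψ t ^ 2)
  set S₂ := opFun G (fun t => ψ t ^ 2)
  have hψ2c : ContinuousOn (fun t => ψ t ^ 2) (realSpectrum G) := hψc.fun_pow 2
  have hκψ2c : ContinuousOn (fun t => κ ^ 2 * ψ t ^ 2) (realSpectrum G) := hψ2c.const_mul _
  have hS : S.IsPositive := isPositive_opFun hWs hdiv.continuousOn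
    fun t ht => div_nonneg (hWI ht).1 hM2.le
  have hS₁ : S₁.IsPositive := isPositive_opFun hGs hκψ2c fun t ht => (hκψ2 t (hGI ht)).1
  have hS₂ : S₂.IsPositive := isPositive_opFun hGs hψ2c fun t ht => (hψ2 t (hGI ht)).1
  have hdivI : ∀ t ∈ realSpectrum (normalOp T), t / M ^ 2 ∈ Set.Icc 0 b := fun t ht =>
    ⟨div_nonneg (hWI ht).1 hM2.le, by rw [div_le_iff₀ hM2, mul_comm]; exact (hWI ht).2⟩
  have hSn : ‖S‖ ≤ b := norm_opFun_le hWs hdiv.continuousOn hb.le fun t ht => by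
    rw [abs_of_nonneg (hdivI t ht).1]; exact (hdivI t ht).2
  have hS₁n : ‖S₁‖ ≤ b := norm_opFun_le hGs hκψ2c hb.le fun t ht => by
    rw [abs_of_nonneg (hκψ2 t (hGI ht)).1]; exact (hκψ2 t (hGI ht)).2
  have hS₂n : ‖S₂‖ ≤ b := norm_opFun_le hGs hψ2c hb.le fun t ht => by
    rw [abs_of_nonneg (hψ2 t (hGI ht)).1]; exact (hψ2 t (hGI ht)).2
  have iS : ∀ y, RCLike.re ⟪S y, y⟫_𝕜 = ‖T y‖ ^ 2 / M ^ 2 := by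
    intro y
    have e : S = ((1 / M ^ 2 : ℝ) : 𝕜) • normalOp T := by
      conv_rhs => rw [← opFun_id hWs]
      rw [opFun_id hWs]
      have := opFun_const_mul hWs (f := fun t => t) (continuousOn_id' _) (1 / M ^ 2)
      rw [opFun_id hWs] at this
      rw [← this]
      simp only [S]
      congr 1
      funext t
      ring
    rw [e, smul_apply, inner_smul_left, RCLike.conj_ofReal, RCLike.re_ofReal_mul,
      re_inner_normalOp]
    ring
  have iS₂ : ∀ y, RCLike.re ⟪S₂ y, y⟫_𝕜 = ‖opFun G ψ y‖ ^ 2 :=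
    fun y => (norm_opFun_apply_sq hGs hψc y).symm
  have iS₁ : ∀ y, RCLike.re ⟪S₁ y, y⟫_𝕜 = κ ^ 2 * ‖opFun G ψ y‖ ^ 2 := by
    intro y
    simp only [S₁]
    rw [opFun_const_mul hGs hψ2c, smul_apply, inner_smul_left, RCLike.conj_ofReal,
      RCLike.re_ofReal_mul, ← iS₂]
  have le₂ : S ≤ S₂ := le_of_re_inner_le hS.isSelfAdjoint hS₂.isSelfAdjoint fun y => by
    rw [iS, iS₂, div_le_iff₀ hM2, mul_comm, ← mul_pow]
    exact pow_le_pow_left₀ (norm_nonneg _) (hup y) 2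
  have le₁ : S₁ ≤ S := le_of_re_inner_le hS₁.isSelfAdjoint hS.isSelfAdjoint fun y => by
    have : κ ^ 2 * ‖opFun G ψ y‖ ^ 2 = (m * ‖opFun G ψ y‖) ^ 2 / M ^ 2 := by
      simp only [κ]; ring
    rw [iS, iS₁, this]
    gcongr
    exact hlow y
  have k₂ := hmon.re_inner_le hb hf2 hS hS₂ hSn hS₂n le₂ x
  have k₁ := hmon.re_inner_le hb hf2 hS₁ hS hS₁n hSn le₁ x
  -- evaluation of the functions of the three operators
  have eS : RCLike.re ⟪opFun S (fun t => f t ^ 2) x, x⟫_𝕜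
      = ‖opFun (normalOp T) (fun t => f (t / M ^ 2)) x‖ ^ 2 := by
    have hfM : ContinuousOn (fun t => f (t / M ^ 2)) (realSpectrum (normalOp T)) :=
      hfc.comp hdiv.continuousOn hdivI
    rw [norm_opFun_apply_sq hWs hfM]
    simp only [S]
    rw [opFun_opFun hWs hdiv.continuousOn (hf2.mono ?_)]
    rintro _ ⟨t, ht, rfl⟩
    exact hdivI t ht
  have hqc := (continuous_rpow_of_nonneg hq).continuousOn (s := realSpectrum G)
  have eS₂ : RCLike.re ⟪opFun S₂ (fun t => f t ^ 2) x, x⟫_𝕜 = ‖opPow G q x‖ ^ 2 := by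
    rw [opPow, norm_opFun_apply_sq hGs hqc]
    simp only [S₂]
    rw [opFun_opFun hGs hψ2c (hf2.mono ?_)]
    · congr 3
      refine (opFun_congr hGs (hqc.fun_pow 2) fun t ht => ?_).symm
      rw [show f (ψ t ^ 2) = t ^ q from invSqrtPow_sq hψ q (hGI ht)]
    · rintro _ ⟨t, ht, rfl⟩
      exact hψ2 t (hGI ht)
  have eS₁ : (κ * ‖opPow G q x‖) ^ 2 ≤ RCLike.re ⟪opFun S₁ (fun t => f t ^ 2) x, x⟫_𝕜 := by
    have hcomp : ContinuousOn (fun t => f (κ ^ 2 * ψ t ^ 2)) (realSpectrum G) :=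
      hfc.comp hκψ2c fun t ht => hκψ2 t (hGI ht)
    have h1 : opFun S₁ (fun t => f t ^ 2) = opFun G (fun t => f (κ ^ 2 * ψ t ^ 2) ^ 2) := by
      refine opFun_opFun hGs hκψ2c (hf2.mono ?_)
      rintro _ ⟨t, ht, rfl⟩
      exact hκψ2 t (hGI ht)
    have h2 : κ * ‖opPow G q x‖ = ‖opFun G (fun t => κ * t ^ q) x‖ := by
      rw [opFun_const_mul hGs hqc, smul_apply, norm_ofReal_smul, abs_of_pos hκ, opPow]
    rw [h1, ← norm_opFun_apply_sq hGs hcomp, h2]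
    -- The remaining scalar inequality `κ f(ψ²) ≤ f(κ² ψ²)` holds because `f(t) / √t` decreases and
    -- `κ ≤ 1`.
    refine pow_le_pow_left₀ (norm_nonneg _)
      (norm_opFun_apply_le hGs (hqc.const_mul κ) hcomp (fun t ht => ?_) x) 2
    have hnn : 0 ≤ f (κ ^ 2 * ψ t ^ 2) := hf.nonneg _ (hκψ2 t (hGI ht))
    have hval : f (ψ t ^ 2) = t ^ q := invSqrtPow_sq hψ q (hGI ht)
    rw [abs_of_nonneg (mul_nonneg hκ.le (Real.rpow_nonneg (hGI ht).1 q)), abs_of_nonneg hnn, ← hval]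
    rcases (hψ.nonneg (hGI ht)).eq_or_lt with h0 | hpos
    · have e0 : ψ t ^ 2 = 0 := by rw [← h0]; ring
      have hnn0 := hf.nonneg 0 ⟨le_rfl, hb.le⟩
      rw [e0, mul_zero]
      exact mul_le_of_le_one_left hnn0 ((div_le_one hM).mpr hmM)
    · have h3 := hf.sqrt_mul_le (hκψ2 t (hGI ht)).1 (t' := ψ t ^ 2)
        ⟨by positivity, (hψ2 t (hGI ht)).2⟩ (mul_le_of_le_one_left (sq_nonneg _) hκ1)
      rw [← mul_pow, Real.sqrt_sq (by positivity), Real.sqrt_sq hpos.le] at h3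
      rw [mul_pow] at h3
      refine le_of_mul_le_mul_left ?_ hpos
      linarith
  constructor
  · rw [← sq_le_sq₀ (norm_nonneg _) (norm_nonneg _), ← eS, ← eS₂]
    exact k₂
  · rw [← sq_le_sq₀ (by positivity) (norm_nonneg _), ← eS]
    exact eS₁.trans k₁

end LinkConditions

/-! ### The scale operators and the information-theoretic lower bound. -/

section BasicFacts

variable {𝕜 X Y : Type*} [RCLike 𝕜] [NormedAddCommGroup X] [InnerProductSpace 𝕜 X]
  [NormedAddCommGroup Y] [InnerProductSpace 𝕜 Y]
  {G : X →L[𝕜] X} {A : X →L[𝕜] Y} {x₀ : X} {p E δ : ℝ}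

theorem scalePow_apply_of_nonneg {r : ℝ} (hr : 0 ≤ r) (z : (scalePow G r).domain) :
    scalePow G r z = opPow G r (z : X) := by
  revert z
  rw [scalePow, if_pos hr]
  intro z
  rfl

theorem scalePow_apply_of_neg {r : ℝ} (hr : r < 0) (hinj : Function.Injective (opPow G (-r)))
    (z : (scalePow G r).domain) : opPow G (-r) (scalePow G r z) = z := by
  revert z
  rw [scalePow, if_neg hr.not_ge]
  intro z
  obtain ⟨ζ, hζ⟩ : (z : X) ∈ LinearMap.range (((opPow G (-r)).toLinearMap.toPMap ⊤).toFun) := by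
    rw [← LinearPMap.inverse_domain]; exact z.2
  have h := LinearPMap.inverse_apply_eq (f := (opPow G (-r)).toLinearMap.toPMap ⊤)
    (LinearMap.ker_eq_bot.mpr fun u v huv => Subtype.ext (hinj huv)) (y := z) (x := ζ) hζ
  rw [h]
  exact hζ

/-- No method is better than half the diameter of the set of indistinguishable sources. -/
theorem ofReal_norm_le_bestWorstCaseError {v : X} (hv : ‖v‖ ≤ E) (hAv : ‖A (opPow G p v)‖ ≤ δ) :
    ENNReal.ofReal ‖opPow G p v‖ ≤ bestWorstCaseError A (sourceSet G x₀ p E) δ := by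
  refine le_iInf fun R => ?_
  have h : ∀ w : X, ‖w‖ ≤ E → ‖A (opPow G p w)‖ ≤ δ →
      ENNReal.ofReal ‖R (A x₀) - (x₀ + opPow G p w)‖
        ≤ worstCaseError A (sourceSet G x₀ p E) δ R := by
    intro w hw hAw
    -- The datum `A x₀` is admissible for both `w = v` and `w = -v`, so the single value `R (A x₀)`
    -- has to serve both.
    refine le_iSup₂_of_le (x₀ + opPow G p w) ⟨w, hw, by abel⟩ ?_
    refine le_iSup₂_of_le (A x₀) ?_ le_rfl
    rwa [map_add, add_sub_cancel_left]
  have h1 := h v hv hAv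
  have h2 := h (-v) (by rwa [norm_neg]) (by rwa [map_neg, map_neg, norm_neg])
  have h3 : ‖opPow G p v‖ ≤ max ‖R (A x₀) - (x₀ + opPow G p v)‖
      ‖R (A x₀) - (x₀ + opPow G p (-v))‖ := by
    have e : (2 : 𝕜) • opPow G p v = (R (A x₀) - (x₀ + opPow G p (-v)))
        - (R (A x₀) - (x₀ + opPow G p v)) := by
      rw [map_neg, two_smul]; abel
    have h4 := norm_sub_le (R (A x₀) - (x₀ + opPow G p (-v))) (R (A x₀) - (x₀ + opPow G p v))
    rw [← e, norm_smul, RCLike.norm_ofNat] at h4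
    rw [le_max_iff]
    by_contra! hcon
    linarith [hcon.1, hcon.2]
  refine (ENNReal.ofReal_le_ofReal h3).trans ?_
  rw [ENNReal.ofReal_max]
  exact max_le h1 h2

end BasicFacts

/-! ### Transformation of the method, source representation of the error and interpolation. -/

section SourceRepresentation

open ContinuousLinearMap

variable {𝕜 X Y : Type*} [RCLike 𝕜]
  [NormedAddCommGroup X] [InnerProductSpace 𝕜 X] [CompleteSpace X]
  [NormedAddCommGroup Y] [InnerProductSpace 𝕜 Y] [CompleteSpace Y]
  {G : X →L[𝕜] X}

variable {A : X →L[𝕜] Y} {s : ℝ} {α : ℕ → ℝ} {y : Y} {x₀ : X} {n : ℕ} {x : ℕ → X}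

/-- The correction `z` lies in the range of `G^(2s)`, so `z = G^s u` with `u = G^s B^(2s) z`;
applying `G^s` to its equation gives the Tikhonov equation for `u`. -/
theorem exists_increment_of_pos (hG : G.IsPositive) (hinj : Function.Injective G) (hs : 0 < s)
    (h : IsImplicitIteration A G s α y x₀ n x) :
    ∀ k ∈ Finset.Icc 1 n, ∃ u : X,
      normalOp (A ∘L opPow G s) u + (α k : 𝕜) • u
          = (A ∘L opPow G s).adjoint (A (x (k - 1)) - y) ∧
        x k = x (k - 1) - opPow G s u := by
  intro k hk
  obtain ⟨z, hz, hxk⟩ := h.2 k hk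
  have hs2 : 0 ≤ 2 * s := by linarith
  have h1 := scalePow_apply_of_neg (G := G) (r := -(2 * s)) (by linarith)
    (by rw [neg_neg]; exact opPow_injective hG hinj hs2) z
  have h2s : ∀ u, opPow G (2 * s) u = opPow G s (opPow G s u) := fun u => by
    rw [two_mul, opPow_add hG hs.le hs.le]
  rw [neg_neg, h2s] at h1
  refine ⟨opPow G s (scalePow G (-(2 * s)) z), ?_, by rw [h1]; exact hxk⟩
  have h2 := congrArg (opPow G s) hz
  rw [map_add, map_smul] at h2
  simp only [normalOp_apply, adjoint_comp, comp_apply, (isSelfAdjoint_opPow hG hs.le).adjoint_eq]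
  rw [h1]
  exact h2

/-- Here `u = G^(-s) z`. Since `A* = G^(-s) T*`, the equation for `z` carries a common factor
`G^(-s)`, which is cancelled by injectivity. -/
theorem exists_increment_of_nonpos (hG : G.IsPositive) (hinj : Function.Injective G) (hs : s ≤ 0)
    {T : X →L[𝕜] Y} (hT : ∀ x, T (opPow G (-s) x) = A x)
    (h : IsImplicitIteration A G s α y x₀ n x) :
    ∀ k ∈ Finset.Icc 1 n, ∃ u : X,
      normalOp T u + (α k : 𝕜) • u = T.adjoint (A (x (k - 1)) - y) ∧
        opPow G (-s) (x k) = opPow G (-s) (x (k - 1)) - u := by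
  intro k hk
  obtain ⟨z, hz, hxk⟩ := h.2 k hk
  have hs' : 0 ≤ -s := by linarith
  have hA : ∀ y, A.adjoint y = opPow G (-s) (T.adjoint y) := by
    have : A = T ∘L opPow G (-s) := by ext u; exact (hT u).symm
    intro y
    rw [this, adjoint_comp, comp_apply, (isSelfAdjoint_opPow hG hs').adjoint_eq]
  refine ⟨opPow G (-s) z, opPow_injective hG hinj hs' ?_, by rw [hxk, map_sub]⟩
  have h2s : ∀ u, opPow G (-(2 * s)) u = opPow G (-s) (opPow G (-s) u) := fun u => by
    rw [← opPow_add hG hs' hs']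
    congr 2
    ring
  rw [scalePow_apply_of_nonneg (by linarith), h2s, hA, hA, ← hT] at hz
  rw [map_add, map_smul, normalOp_apply]
  exact hz

theorem exists_transformed_iterates (hG : G.IsPositive) (hinj : Function.Injective G) (hs : 0 < s)
    (h : IsImplicitIteration A G s α y x₀ n x) :
    ∃ U u : ℕ → X, U 0 = 0 ∧ (∀ k ∈ Finset.Icc 1 n, U k = U (k - 1) - u k) ∧
      (∀ k ≤ n, x k = x₀ + opPow G s (U k)) ∧
      ∀ k ∈ Finset.Icc 1 n, normalOp (A ∘L opPow G s) (u k) + (α k : 𝕜) • u k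
        = (A ∘L opPow G s).adjoint (A (x (k - 1)) - y) := by
  choose! u hu hx using exists_increment_of_pos hG hinj hs h
  have hU : ∀ k ∈ Finset.Icc 1 n, -∑ j ∈ Finset.range k, u (j + 1)
      = -∑ j ∈ Finset.range (k - 1), u (j + 1) - u k := by
    intro k hk
    obtain ⟨j, rfl⟩ : ∃ j, k = j + 1 := ⟨k - 1, by rw [Finset.mem_Icc] at hk; omega⟩
    rw [Finset.sum_range_succ, add_tsub_cancel_right]
    abel
  refine ⟨fun k => -∑ j ∈ Finset.range k, u (j + 1), u, by simp, hU, ?_, hu⟩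
  intro k
  induction k with
  | zero => intro _; simp [h.1]
  | succ k ih =>
    intro hk
    have hmem : k + 1 ∈ Finset.Icc 1 n := by rw [Finset.mem_Icc]; omega
    have h1 := hx _ hmem
    have h2 := hU _ hmem
    rw [add_tsub_cancel_right] at h1 h2
    simp only [] at ih ⊢
    rw [h1, ih (by omega), h2, map_sub]
    abel

variable {ϱ : ℝ → ℝ} {m M p : ℝ}

/-- For `s ≤ 0` the operator `A G^s` is only densely defined; as `ψ_s(G) G^(-s) = ϱ(G)`, the upper
link condition bounds it, and both link conditions pass to the closure. -/
theorem exists_link_operator (hG : G.IsPositive) (hinj : Function.Injective G) (hs : s ≤ 0)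
    (hψ : IsIndexFunction ‖G‖ (psi ϱ s)) (hϱ : IsIndexFunction ‖G‖ ϱ)
    (hlow : ∀ x, m * ‖opFun G ϱ x‖ ≤ ‖A x‖) (hup : ∀ x, ‖A x‖ ≤ M * ‖opFun G ϱ x‖)
    (hM : 0 < M) :
    ∃ T : X →L[𝕜] Y, (∀ x, T (opPow G (-s) x) = A x) ∧
      (∀ u, m * ‖opFun G (psi ϱ s) u‖ ≤ ‖T u‖) ∧ ∀ u, ‖T u‖ ≤ M * ‖opFun G (psi ϱ s) u‖ := by
  have hs' : 0 ≤ -s := by linarith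
  have hd := denseRange_opPow hG hinj hs'
  have e : ∀ x, opFun G (psi ϱ s) (opPow G (-s) x) = opFun G ϱ x := by
    refine opFun_opPow hG hs' hψ.2.1 fun t ht => ?_
    rcases ht.1.eq_or_lt with rfl | hpos
    · simp [psi, hϱ.1]
    · rw [psi, Real.rpow_neg hpos.le]
      have := Real.rpow_pos_of_pos hpos s
      field_simp
  obtain ⟨T, hT, -⟩ := exists_factor hd A (C := M * ‖opFun G (psi ϱ s)‖) fun x => by
    rw [mul_assoc]
    refine (hup x).trans (mul_le_mul_of_nonneg_left ?_ hM.le)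
    rw [← e]
    exact le_opNorm _ _
  refine ⟨T, hT, fun u => ?_, fun u => ?_⟩
  · refine hd.induction_on u (isClosed_le (by fun_prop) (by fun_prop)) fun x => ?_
    rw [e, hT]; exact hlow x
  · refine hd.induction_on u (isClosed_le (by fun_prop) (by fun_prop)) fun x => ?_
    rw [e, hT]; exact hup x

variable {E C₁ δ : ℝ} {xdag : X}

theorem exists_source_low_order (hG : G.IsPositive) (hinj : Function.Injective G) (hG0 : 0 < ‖G‖)
    (hm : 0 < m) (hmM : m ≤ M) (hC : 1 < C₁) (hϱ : IsIndexFunction ‖G‖ ϱ)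
    (hlow : ∀ x, m * ‖opFun G ϱ x‖ ≤ ‖A x‖) (hup : ∀ x, ‖A x‖ ≤ M * ‖opFun G ϱ x‖)
    (hp : 0 < p) (hψ : IsIndexFunction ‖G‖ (psi ϱ s)) (hsp : s ≤ p)
    (hmon : OperatorMonotone 𝕜 X (psi ϱ s ‖G‖ ^ 2) (fun t => hFun ‖G‖ ϱ p s t ^ 2))
    (hanti : AntitoneOn (fun t => hFun ‖G‖ ϱ p s t / √t) (Set.Ioc 0 (psi ϱ s ‖G‖ ^ 2)))
    (hx : xdag ∈ sourceSet G x₀ p E) (hη : ‖A xdag - y‖ ≤ δ) (hα : ∀ k ∈ Finset.Icc 1 n, 0 < α k)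
    (hit : IsImplicitIteration A G s α y x₀ n x) (hdisc : C₁ * δ ≤ ‖A (x n) - y‖) :
    ∃ v' : X, ‖v'‖ ≤ E / (m / M) * (1 + 1 / (C₁ - 1)) ∧ opPow G p v' = x n - xdag := by
  have hM : 0 < M := hm.trans_le hmM
  obtain ⟨v, hv, hxv⟩ := hx
  have hq : 0 ≤ p - s := by linarith
  have hf : IsLinkFunction (psi ϱ s ‖G‖ ^ 2) (invSqrtPow ‖G‖ (psi ϱ s) (p - s)) :=
    isLinkFunction_invSqrtPow hψ hG0 hq hanti
  have hη' : ‖y - A xdag‖ ≤ δ := by rw [norm_sub_rev]; exact hη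
  -- Common to both signs of `s`; only the construction of `T` and of the transformed errors `V`
  -- differs.
  have main : ∀ {T : X →L[𝕜] Y} {V u : ℕ → X},
      (∀ u, m * ‖opFun G (psi ϱ s) u‖ ≤ ‖T u‖) → (∀ u, ‖T u‖ ≤ M * ‖opFun G (psi ϱ s) u‖) →
      V 0 = -opPow G (p - s) v → (∀ k ∈ Finset.Icc 1 n, V k = V (k - 1) - u k) →
      (∀ k ≤ n, T (V k) = A (x k) - A xdag) →
      (∀ k ∈ Finset.Icc 1 n, normalOp T (u k) + (α k : 𝕜) • u k
        = T.adjoint (A (x (k - 1)) - y)) →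
      ∃ v' : X, ‖v'‖ ≤ E / (m / M) * (1 + 1 / (C₁ - 1)) ∧ opPow G (p - s) v' = V n := by
    intro T V u hTl hTu hV0 hV hTV hu
    have hlink := link_of_operatorMonotone hG hψ hm hmM hTl hTu hq hf hmon
    refine low_order_bound (T := T) (η := y - A xdag) (isSelfAdjoint_opPow hG hq)
      (denseRange_opPow hG hinj hq) (hf.comp_div (pow_pos hM 2))
      (realSpectrum_normalOp_subset_Icc hG hψ hM hTu) (div_pos hm hM)
      (fun u => (hlink u).1) (fun u => (hlink u).2) hα hV0 hv hη' hC hV (fun k hk => ?_) ?_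
    · rw [hu k hk, hTV (k - 1) (by rw [Finset.mem_Icc] at hk; omega)]
      congr 1
      abel
    · rw [hTV n le_rfl, sub_sub_sub_cancel_right]
      exact hdisc
  rcases lt_or_ge 0 s with hs | hs
  · obtain ⟨U, u, hU0, hU, hxU, hu⟩ := exists_transformed_iterates hG hinj hs hit
    have hpv : opPow G p v = opPow G s (opPow G (p - s) v) := by
      rw [← opPow_add hG hs.le hq, add_sub_cancel]
    have eψ : ∀ u, opFun G ϱ (opPow G s u) = opFun G (psi ϱ s) u :=
      opFun_opPow hG hs.le hϱ.2.1 fun t _ => mul_comm _ _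
    have hxe : ∀ k ≤ n, x k - xdag = opPow G s (U k - opPow G (p - s) v) := by
      intro k hk
      rw [hxU k hk, map_sub, ← hpv, ← hxv]
      abel
    obtain ⟨v', hv', hQv⟩ := main (T := A ∘L opPow G s) (V := fun k => U k - opPow G (p - s) v)
      (u := u) (fun u => by rw [← eψ]; exact hlow _) (fun u => by rw [← eψ]; exact hup _)
      (by simp [hU0]) (fun k hk => by rw [hU k hk]; abel)
      (fun k hk => by rw [comp_apply, ← hxe k hk, map_sub]) hu
    refine ⟨v', hv', ?_⟩
    rw [hxe n le_rfl, ← hQv, ← opPow_add hG hs.le hq, add_sub_cancel]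
  · have hs' : 0 ≤ -s := by linarith
    obtain ⟨T, hT, hTl, hTu⟩ := exists_link_operator hG hinj hs hψ hϱ hlow hup hM
    choose! u hu hxu using exists_increment_of_nonpos hG hinj hs hT hit
    have hpv : ∀ v, opPow G (p - s) v = opPow G (-s) (opPow G p v) := fun v => by
      rw [← opPow_add hG hs' hp.le, neg_add_eq_sub]
    obtain ⟨v', hv', hQv⟩ := main (T := T) (V := fun k => opPow G (-s) (x k - xdag)) (u := u)
      hTl hTu (by rw [hpv, ← hxv, hit.1, ← map_neg, neg_sub])
      (fun k hk => by rw [map_sub, map_sub, hxu k hk]; abel)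
      (fun k hk => by rw [hT, map_sub]) hu
    refine ⟨v', hv', opPow_injective hG hinj hs' ?_⟩
    rw [← hpv, hQv]

theorem exists_source_high_order (hG : G.IsPositive) (hinj : Function.Injective G)
    (hG0 : 0 < ‖G‖)
    (hm : 0 < m) (hmM : m ≤ M) (hC : 1 < C₁) (hϱ : IsIndexFunction ‖G‖ ϱ)
    (hlow : ∀ x, m * ‖opFun G ϱ x‖ ≤ ‖A x‖) (hup : ∀ x, ‖A x‖ ≤ M * ‖opFun G ϱ x‖)
    (hp : 0 < p) (hψ : IsIndexFunction ‖G‖ (psi ϱ s)) (hps : p ≤ s)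
    (hmon : OperatorMonotone 𝕜 X (psi ϱ s ‖G‖ ^ 2) (fun t => wFun ‖G‖ ϱ p s t ^ 2))
    (hx : xdag ∈ sourceSet G x₀ p E) (hη : ‖A xdag - y‖ ≤ δ) (hα : ∀ k ∈ Finset.Icc 1 n, 0 < α k)
    (hit : IsImplicitIteration A G s α y x₀ n x) (hdisc : C₁ * δ ≤ ‖A (x n) - y‖) :
    ∃ v' : X, ‖v'‖ ≤ E + E / (m / M) * (1 + 1 / (C₁ - 1)) ∧ opPow G p v' = x n - xdag := by
  have hM : 0 < M := hm.trans_le hmM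
  obtain ⟨v, hv, hxv⟩ := hx
  have hs : 0 < s := hp.trans_le hps
  have hq : 0 ≤ s - p := by linarith
  have hf : IsLinkFunction (psi ϱ s ‖G‖ ^ 2) (invSqrtPow ‖G‖ (psi ϱ s) (s - p)) :=
    isLinkFunction_invSqrtPow hψ hG0 hq (antitoneOn_of_high_order hϱ hG0 hp hψ)
  have hw : wFun ‖G‖ ϱ p s = invSqrtPow ‖G‖ (psi ϱ s) (s - p) := by
    funext t
    rw [wFun, hFun, invSqrtPow, one_div,
      ← Real.rpow_neg (indexInv_mem hψ hG0.le (Real.sqrt_nonneg t)).1, neg_sub]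
  rw [hw] at hmon
  have hη' : ‖y - A xdag‖ ≤ δ := by rw [norm_sub_rev]; exact hη
  obtain ⟨U, u, hU0, hU, hxU, hu⟩ := exists_transformed_iterates hG hinj hs hit
  have eψ : ∀ u, opFun G ϱ (opPow G s u) = opFun G (psi ϱ s) u :=
    opFun_opPow hG hs.le hϱ.2.1 fun t _ => mul_comm _ _
  have hTl : ∀ u, m * ‖opFun G (psi ϱ s) u‖ ≤ ‖(A ∘L opPow G s) u‖ := fun u => by
    rw [← eψ]; exact hlow _
  have hTu : ∀ u, ‖(A ∘L opPow G s) u‖ ≤ M * ‖opFun G (psi ϱ s) u‖ := fun u => by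
    rw [← eψ]; exact hup _
  have hsu : ∀ u, opPow G s u = opPow G p (opPow G (s - p) u) := fun u => by
    rw [← opPow_add hG hp.le hq, add_sub_cancel]
  have hres : ∀ k ≤ n, A (x k) - y
      = (A ∘L opPow G s) (U k) - ((A ∘L opPow G p) v + (y - A xdag)) := by
    intro k hk
    rw [hxU k hk, comp_apply, comp_apply, ← hxv, map_sub, map_add]
    abel
  have hlink := link_of_operatorMonotone hG hψ hm hmM hTl hTu hq hf hmon
  have hbound := high_order_bound (T := A ∘L opPow G s) (L := A ∘L opPow G p) (v := v)
    (η := y - A xdag) (denseRange_opPow hG hinj hq) (hf.comp_div (pow_pos hM 2))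
    (realSpectrum_normalOp_subset_Icc hG hψ hM hTu) (div_pos hm hM)
    (fun u => (hlink u).1) (fun u => (hlink u).2)
    (fun u => by rw [comp_apply, comp_apply, hsu]) hα hU0 hv hη' hC hU
    (fun k hk => by rw [hu k hk, hres (k - 1) (by rw [Finset.mem_Icc] at hk; omega)])
    (by rw [← hres n le_rfl]; exact hdisc)
  -- Since `x n - x₀ = G^p G^(s-p) U n` and `x† - x₀ = G^p v`, subtracting `v` costs the extra
  -- summand `E` in the bound.
  refine ⟨opPow G (s - p) (U n) - v, ?_, ?_⟩
  · exact (norm_sub_le _ _).trans (by linarith)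
  · rw [map_sub, ← hsu, hxU n le_rfl, ← hxv]
    abel

/-- The interpolation step: a source representation and a small image yield the error bound. -/
theorem norm_opPow_le (hG : G.IsPositive) (hG0 : 0 < ‖G‖) (hϱ : IsIndexFunction ‖G‖ ϱ) (hp : 0 < p)
    {v : X} {τ : ℝ} (hE : 0 < E) (hτ : 0 < τ) (hv : ‖v‖ ≤ E) (hvτ : ‖opFun G (psi ϱ p) v‖ ≤ τ) :
    ‖opPow G p v‖ ≤ 2 * E * indexInv ‖G‖ (psi ϱ p) (τ / E) ^ p := by
  have hGs := hG.isSelfAdjoint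
  have hGI := realSpectrum_subset_Icc hG
  have hψ := isIndexFunction_psi hϱ hp.le
  have hpc := (continuous_rpow_of_nonneg hp.le).continuousOn (s := realSpectrum G)
  have hψc : ContinuousOn (psi ϱ p) (realSpectrum G) := hψ.2.1.mono hGI
  have hτE : 0 < τ / E := div_pos hτ hE
  rcases le_or_gt (psi ϱ p ‖G‖) (τ / E) with h | h
  · rw [indexInv_of_ge hG0.le h]
    have h1 : ‖opPow G p‖ ≤ ‖G‖ ^ p := by
      refine norm_opFun_le hGs hpc (by positivity) fun t ht => ?_
      rw [abs_of_nonneg (Real.rpow_nonneg (hGI ht).1 p)]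
      exact Real.rpow_le_rpow (hGI ht).1 (hGI ht).2 hp.le
    have h2 := le_of_opNorm_le _ h1 v
    have h3 : 0 < ‖G‖ ^ p := Real.rpow_pos_of_pos hG0 p
    nlinarith
  · obtain ⟨t₀, ht₀, ht₀τ⟩ := hψ.exists_eq hG0.le hτE.le h.le
    rw [← ht₀τ, indexInv_apply hψ ht₀]
    have ht₀pos : 0 < t₀ := by
      refine lt_of_le_of_ne ht₀.1 ?_
      rintro rfl
      rw [hψ.1] at ht₀τ
      exact hτE.ne ht₀τ
    have hP : 0 < t₀ ^ p := Real.rpow_pos_of_pos ht₀pos p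
    have hΨ : 0 < psi ϱ p t₀ := by rw [ht₀τ]; exact hτE
    have hϱ₀ : 0 < ϱ t₀ := hϱ.pos ⟨ht₀pos, ht₀.2⟩
    -- With this weight, `c ψ_p(t)²` dominates `t^(2p)` for `t ≥ t₀`, because `ϱ(t) ≥ ϱ(t₀)`. Each
    -- of the two terms then contributes at most `t₀^(2p) E²`.
    set c := (t₀ ^ p / psi ϱ p t₀) ^ 2
    have hpt : ∀ t ∈ realSpectrum G, (t ^ p) ^ 2 ≤ c * psi ϱ p t ^ 2 + (t₀ ^ p) ^ 2 := by
      intro t ht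
      have htp : 0 ≤ t ^ p := Real.rpow_nonneg (hGI ht).1 p
      rcases le_total t t₀ with htt | htt
      · have h1 := pow_le_pow_left₀ htp (Real.rpow_le_rpow (hGI ht).1 htt hp.le) 2
        have h2 : 0 ≤ c * psi ϱ p t ^ 2 := by positivity
        linarith
      · have h1 : t ^ p ≤ t₀ ^ p / psi ϱ p t₀ * psi ϱ p t := by
          rw [div_mul_eq_mul_div, le_div_iff₀ hΨ, psi, psi]
          have := hϱ.2.2.monotoneOn ht₀ (hGI ht) htt
          have h3 : 0 ≤ t ^ p * t₀ ^ p := by positivity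
          nlinarith
        have h2 := pow_le_pow_left₀ htp h1 2
        rw [mul_pow] at h2
        have h3 : 0 ≤ (t₀ ^ p) ^ 2 := by positivity
        linarith
    have k := re_inner_opFun_le hGs (g := fun t => c * psi ϱ p t ^ 2 + (t₀ ^ p) ^ 2)
      (hpc.fun_pow 2) (((hψc.fun_pow 2).const_mul c).fun_add continuousOn_const) hpt v
    rw [re_inner_opFun_add_const hGs ((hψc.fun_pow 2).const_mul c),
      opFun_const_mul hGs (hψc.fun_pow 2), smul_apply, inner_smul_left, RCLike.conj_ofReal,
      RCLike.re_ofReal_mul, ← norm_opFun_apply_sq hGs hψc, ← norm_opFun_apply_sq hGs hpc] at k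
    change ‖opPow G p v‖ ^ 2 ≤ _ at k
    have k1 : c * ‖opFun G (psi ϱ p) v‖ ^ 2 ≤ (t₀ ^ p) ^ 2 * E ^ 2 := by
      have : c * τ ^ 2 = (t₀ ^ p) ^ 2 * E ^ 2 := by
        simp only [c]
        rw [ht₀τ]
        field_simp
      rw [← this]
      gcongr
    have k2 : (t₀ ^ p) ^ 2 * ‖v‖ ^ 2 ≤ (t₀ ^ p) ^ 2 * E ^ 2 := by gcongr
    refine (sq_le_sq₀ (norm_nonneg _) (by positivity)).mp ?_
    have k3 : 0 ≤ (t₀ ^ p) ^ 2 * E ^ 2 := by positivity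
    have k4 : (2 * E * t₀ ^ p) ^ 2 = 4 * ((t₀ ^ p) ^ 2 * E ^ 2) := by ring
    linarith

end SourceRepresentation

/-! ### Lower bound for arbitrary methods. -/

section LowerBound

open ContinuousLinearMap

variable {𝕜 X Y : Type*} [RCLike 𝕜]
  [NormedAddCommGroup X] [InnerProductSpace 𝕜 X] [CompleteSpace X]
  [NormedAddCommGroup Y] [InnerProductSpace 𝕜 Y] {A : X →L[𝕜] Y} {G : X →L[𝕜] X} {ϱ : ℝ → ℝ}
  {M p E δ : ℝ} {x₀ : X}

theorem exists_lower_bound (hG : G.IsPositive) (hϱ : IsIndexFunction ‖G‖ ϱ) (hp : 0 < p)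
    (hup : ∀ x, ‖A x‖ ≤ M * ‖opFun G ϱ x‖) (hM : 0 < M) (hE : 0 < E) (hδ : 0 < δ)
    (hsp : δ / (M * E) ∈ realSpectrum (opFun G (psi ϱ p))) :
    ∃ t ∈ Set.Ioc 0 ‖G‖, psi ϱ p t = δ / (M * E) ∧ ENNReal.ofReal (E / 4 * t ^ p)
      ≤ bestWorstCaseError A (sourceSet G x₀ p E) δ := by
  have hGs := hG.isSelfAdjoint
  have hGI := realSpectrum_subset_Icc hG
  have hψ := isIndexFunction_psi hϱ hp.le
  have hpc := (continuous_rpow_of_nonneg hp.le).continuousOn (s := realSpectrum G)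
  have hψc : ContinuousOn (psi ϱ p) (realSpectrum G) := hψ.2.1.mono hGI
  obtain ⟨t, ht, htδ⟩ := realSpectrum_opFun_subset hGs hψc hsp
  have hΨ : 0 < psi ϱ p t := by rw [htδ]; positivity
  have ht0 : 0 < t := by
    refine lt_of_le_of_ne (hGI ht).1 ?_
    rintro rfl
    rw [hψ.1] at hΨ
    exact hΨ.false
  have hP : 0 < t ^ p := Real.rpow_pos_of_pos ht0 p
  refine ⟨t, ⟨ht0, (hGI ht).2⟩, htδ, ?_⟩
  -- These accuracies give `‖ψ_p(G) v‖ ≤ 2 ψ_p(t)` and `‖G^p v‖ ≥ t^p / 2`. Scaling `v` by `E/2`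
  -- then makes the data perturbation exactly at most `δ` and leaves the norm `E/4 t^p`.
  obtain ⟨η₁, hη₁, h₁⟩ := exists_opFun_approx hGs hψc ht hΨ
  obtain ⟨η₂, hη₂, h₂⟩ := exists_opFun_approx hGs hpc ht (half_pos hP)
  obtain ⟨v, hv, hvt⟩ := exists_approx_eigenvector hGs ht (lt_min hη₁ hη₂)
  have k₁ := h₁ v hv (hvt.trans (min_le_left _ _))
  have k₂ := h₂ v hv (hvt.trans (min_le_right _ _))
  have e₁ : ‖((psi ϱ p t : ℝ) : 𝕜) • v‖ = psi ϱ p t := by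
    rw [norm_ofReal_smul, hv, mul_one, abs_of_pos hΨ]
  have e₂ : ‖((t ^ p : ℝ) : 𝕜) • v‖ = t ^ p := by
    rw [norm_ofReal_smul, hv, mul_one, abs_of_pos hP]
  have l₁ : ‖opFun G (psi ϱ p) v‖ ≤ 2 * psi ϱ p t := by
    have := norm_sub_norm_le (opFun G (psi ϱ p) v) (((psi ϱ p t : ℝ) : 𝕜) • v)
    linarith
  have l₂ : t ^ p / 2 ≤ ‖opPow G p v‖ := by
    have := norm_sub_norm_le (((t ^ p : ℝ) : 𝕜) • v) (opPow G p v)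
    rw [norm_sub_rev] at this
    change ‖opPow G p v - _‖ ≤ _ at k₂
    linarith
  have hE2 : |E / 2| = E / 2 := abs_of_pos (half_pos hE)
  have l₃ : E / 4 * t ^ p ≤ ‖opPow G p (((E / 2 : ℝ) : 𝕜) • v)‖ := by
    rw [map_smul, norm_ofReal_smul, hE2]
    nlinarith
  refine (ENNReal.ofReal_le_ofReal l₃).trans (ofReal_norm_le_bestWorstCaseError ?_ ?_)
  · rw [norm_ofReal_smul, hE2, hv]; linarith
  · have eψ : ∀ u, opFun G ϱ (opPow G p u) = opFun G (psi ϱ p) u :=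
      opFun_opPow hG hp.le hϱ.2.1 fun t _ => mul_comm _ _
    rw [map_smul, map_smul, norm_ofReal_smul, hE2]
    have l₄ : ‖A (opPow G p v)‖ ≤ M * (2 * psi ϱ p t) := by
      refine (hup _).trans ?_
      rw [eψ]
      gcongr
    calc E / 2 * ‖A (opPow G p v)‖ ≤ E / 2 * (M * (2 * psi ϱ p t)) := by gcongr
      _ = δ := by rw [htδ]; field_simp

end LowerBound

end HilbertScale

end

/-! ### The error bound and its order optimality. -/

theorem theorem4p5 (m M E C₁ C₂ : ℝ) (hm : 0 < m) (hmM : m ≤ M) (hE : 0 < E)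
    (hC₁ : 1 < C₁) (hC₁₂ : C₁ ≤ C₂) :
    ∃ c₁ c₂ c₃ : ℝ, 0 < c₁ ∧ 0 < c₂ ∧ 0 < c₃ ∧
      ∀ (𝕜 : Type*) (X : Type*) (Y : Type*) [RCLike 𝕜]
        [NormedAddCommGroup X] [InnerProductSpace 𝕜 X] [CompleteSpace X]
        [NormedAddCommGroup Y] [InnerProductSpace 𝕜 Y] [CompleteSpace Y]
        (A : X →L[𝕜] Y) (G : X →L[𝕜] X) (ϱ : ℝ → ℝ) (p s : ℝ) (x₀ : X),
        -- `G` is the inverse of the operator that generates the Hilbert scale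
        G.IsPositive → Function.Injective G →
        -- the two link conditions
        HilbertScale.IsIndexFunction ‖G‖ ϱ →
        (∀ x : X, m * ‖HilbertScale.opFun G ϱ x‖ ≤ ‖A x‖) →
        (∀ x : X, ‖A x‖ ≤ M * ‖HilbertScale.opFun G ϱ x‖) →
        -- the parameters, and the monotonicity hypotheses of the high and the low order case
        0 < p →
        HilbertScale.IsIndexFunction ‖G‖ (HilbertScale.psi ϱ s) →
        ((p ≤ s ∧
            HilbertScale.OperatorMonotone 𝕜 X (HilbertScale.psi ϱ s ‖G‖ ^ 2)
              (fun t => HilbertScale.wFun ‖G‖ ϱ p s t ^ 2)) ∨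
          (s ≤ p ∧
            HilbertScale.OperatorMonotone 𝕜 X (HilbertScale.psi ϱ s ‖G‖ ^ 2)
              (fun t => HilbertScale.hFun ‖G‖ ϱ p s t ^ 2) ∧
            AntitoneOn (fun t => HilbertScale.hFun ‖G‖ ϱ p s t / √t)
              (Set.Ioc 0 (HilbertScale.psi ϱ s ‖G‖ ^ 2)))) →
        ConvexOn ℝ (Set.Ioc 0 (‖G‖ ^ (2 * p))) (HilbertScale.xiFun ϱ p) →
        -- the error bound
        (∀ (δ : ℝ) (xdag : X) (yδ : Y) (α : ℕ → ℝ) (n : ℕ) (x : ℕ → X),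
          0 < δ →
          xdag ∈ HilbertScale.sourceSet G x₀ p E →
          ‖A xdag - yδ‖ ≤ δ →
          (∀ k ∈ Finset.Icc 1 n, 0 < α k) →
          HilbertScale.IsImplicitIteration A G s α yδ x₀ n x →
          C₁ * δ ≤ ‖A (x n) - yδ‖ →
          ‖A (x n) - yδ‖ ≤ C₂ * δ →
          ‖x n - xdag‖ ≤
            c₁ * HilbertScale.indexInv ‖G‖ (HilbertScale.psi ϱ p) (c₂ * δ) ^ p) ∧
        -- the bound is order optimal on the source set
        (∀ δ : ℝ, 0 < δ →
          ((δ / (M * E) : ℝ) : 𝕜) ∈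
            spectrum 𝕜 (HilbertScale.opFun G (HilbertScale.psi ϱ p)) →
          ENNReal.ofReal
              (c₁ * HilbertScale.indexInv ‖G‖ (HilbertScale.psi ϱ p) (c₂ * δ) ^ p) ≤
            ENNReal.ofReal c₃ *
              HilbertScale.bestWorstCaseError A (HilbertScale.sourceSet G x₀ p E) δ) := by
  have hM : 0 < M := hm.trans_le hmM
  have hC₁' : 0 < C₁ - 1 := by linarith
  -- `E'` is the high order source bound, which also dominates the low order one. Below, `τ δ`
  -- bounds `‖ψ_p(G) v'‖`: the residual `C₂ δ` plus the noise `δ`, divided by `m`.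
  set E' := E + E / (m / M) * (1 + 1 / (C₁ - 1)) with hE'
  have hE'pos : 0 < E' := by positivity
  set τ := (C₂ + 1) / m
  have hτ : 0 < τ := div_pos (by linarith) hm
  refine ⟨2 * E', τ / E', 4 * (2 * E') * (1 + τ / E' * (M * E)) / E, by positivity, by positivity,
    by positivity, ?_⟩
  intro 𝕜 X Y _ _ _ _ _ _ _ A G ϱ p s x₀ hG hinj hϱ hlow hup hp hψ hcase _
  have hψp := HilbertScale.isIndexFunction_psi hϱ hp.le
  constructor
  · intro δ xdag yδ α n x hδ hx hη hα hit hd₁ hd₂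
    -- If `G = 0`, injectivity makes `X` trivial.
    rcases (norm_nonneg G).eq_or_lt with h0 | hG0
    · have hX : Subsingleton X := ⟨fun u v => hinj (by
        rw [norm_eq_zero.mp h0.symm]; rfl)⟩
      rw [Subsingleton.elim (x n - xdag) 0, norm_zero]
      exact mul_nonneg (by positivity) (Real.rpow_nonneg
        (HilbertScale.indexInv_mem hψp (norm_nonneg G) (by positivity)).1 p)
    · obtain ⟨v', hv', he⟩ : ∃ v' : X, ‖v'‖ ≤ E' ∧ HilbertScale.opPow G p v' = x n - xdag := by
        rcases hcase with ⟨hps, hmon⟩ | ⟨hsp, hmon, hanti⟩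
        · exact HilbertScale.exists_source_high_order hG hinj hG0 hm hmM hC₁ hϱ hlow hup hp hψ hps
            hmon hx hη hα hit hd₁
        · obtain ⟨v', hv', he⟩ := HilbertScale.exists_source_low_order hG hinj hG0 hm hmM hC₁ hϱ
            hlow hup hp hψ hsp hmon hanti hx hη hα hit hd₁
          exact ⟨v', hv'.trans (by rw [hE']; linarith), he⟩
      have hres : ‖HilbertScale.opFun G (HilbertScale.psi ϱ p) v'‖ ≤ τ * δ := by
        have hcomp : HilbertScale.opFun G ϱ (HilbertScale.opPow G p v') =
            HilbertScale.opFun G (HilbertScale.psi ϱ p) v' :=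
          HilbertScale.opFun_opPow hG hp.le hϱ.2.1 (fun t _ => mul_comm _ _) v'
        rw [← hcomp, he, div_mul_eq_mul_div, le_div_iff₀ hm, mul_comm]
        refine (hlow _).trans ?_
        rw [map_sub, ← sub_add_sub_cancel _ yδ]
        refine (norm_add_le _ _).trans ?_
        rw [norm_sub_rev yδ]
        linarith
      rw [← he, div_mul_eq_mul_div]
      exact HilbertScale.norm_opPow_le hG hG0 hϱ hp hE'pos (by positivity) hv' hres
  · intro δ hδ hsp
    obtain ⟨t, ht, htδ, hle⟩ := HilbertScale.exists_lower_bound (A := A) (x₀ := x₀) hG hϱ hp hup hM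
      hE hδ hsp
    -- Since `δ = M E ψ_p(t)`, the upper bound is at most `2 E' (1 + c) t^p` with `c = (τ / E') M
    -- E`; dividing by the lower bound `E/4 t^p` gives `c₃`.
    have h1 : τ / E' * δ = τ / E' * (M * E) * HilbertScale.psi ϱ p t := by
      rw [htδ]
      field_simp
    have h2 := HilbertScale.indexInv_rpow_le hϱ hp ht
      (c := τ / E' * (M * E)) (by positivity)
    rw [h1]
    refine le_trans ?_ (mul_le_mul_right hle _)
    rw [← ENNReal.ofReal_mul (by positivity)]
    refine ENNReal.ofReal_le_ofReal ?_
    refine (mul_le_mul_of_nonneg_left h2 (by positivity)).trans_eq ?_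
    field_simp
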